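/- **Theorem.** Let $K\ge 1$ and $1\le T\le N\le M$ be integers. *Model.* There are $K$ messages $W_1,\dots,W_K$, random variables on a common probability space with values in a finite alphabet $\mathcal W$, with $H(W_1,\dots,W_K)=\sum_k H(W_k)$ and $H(W_1)=\cdots=H(W_K)=\log_2|\mathcal W|$ (independent messages of size $L=\log_2|\mathcal W|$ bits each; entropies are in bits). Each of $M$ databases stores all the messages. To retrieve $W_k$, the user generates finite-valued random queries $Q_1^{[k]},\dots,Q_M^{[k]}$ with $I(W_1,\dots,W_K;Q_1^{[k]},\dots,Q_M^{[k]})=0$. Database $n$ returns an answer $A_n^{[k]}=f_n(Q_n^{[k]},W_1,\dots,W_K)$, a finite-valued deterministic function (not depending on $k$) of the received query and the messages. A *robust $T$-private PIR scheme* consists of such data satisfying - (correctness from any $N$ answers) $H\big(W_k\mid (A_n^{[k]})_{n\in\mathcal N},Q_1^{[k]},\dots,Q_M^{[k]}\big)=0$ for every $k$ and every $\mathcal N\subseteq\{1,\dots,M\}$ with $|\mathcal N|=N$; - ($T$-privacy) for every $\mathcal T\subseteq\{1,\dots,M\}$ with $|\mathcal T|=T$, the joint law of $(Q_n^{[k]})_{n\in\mathcal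 T}$ does not depend on $k$. For a desired index $k$ and a responding set $\mathcal N$ with $|\mathcal N|=N$, put $R(k,\mathcal N)=L\big/\sum_{n\in\mathcal N}H(A_n^{[k]})$. The rate of the scheme is $R=\min_{k,\mathcal N}R(k,\mathcal N)$. The capacity $C$ is the supremum of $R$ over all robust $T$-private PIR schemes with messages in $\mathcal W=\{0,1\}^L$, over all $L\ge 1$. *Claim.* The capacity is $$C=\left(1+\frac{T}{N}+\frac{T^2}{N^2}+\cdots+\frac{T^{K-1}}{N^{K-1}}\right)^{-1},$$ independently of $M$. Moreover $R(k,\mathcal N)\le C$ for every such scheme, over any finite message alphabet $\mathcal W$, every $k$ and every $\mathcal N$ with $|\mathcal N|=N$; so measuring the rate on the best rather than the worst responding set gives the same capacity. -/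

import Mathlib

open MeasureTheory

namespace PIR

section Entropy

variable {Ω : Type} [MeasurableSpace Ω] (μ : Measure Ω)

/-- Shannon entropy `H(X)`, in bits, of a random variable with values in a finite set. -/
noncomputable def entropy {α : Type} [Fintype α] (X : Ω → α) : ℝ :=
  ∑ x : α, Real.negMulLog (μ.real (X ⁻¹' {x})) / Real.log 2

/-- Conditional entropy `H(X | Y) = H(X, Y) - H(Y)`, in bits. -/
noncomputable def condEntropy {α β : Type} [Fintype α] [Fintype β]
    (X : Ω → α) (Y : Ω → β) : ℝ :=
  entropy μ (fun ω => (X ω, Y ω)) - entropy μ Y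

/-- Mutual information `I(X; Y) = H(X) + H(Y) - H(X, Y)`, in bits. -/
noncomputable def mutualInfo {α β : Type} [Fintype α] [Fintype β]
    (X : Ω → α) (Y : Ω → β) : ℝ :=
  entropy μ X + entropy μ Y - entropy μ (fun ω => (X ω, Y ω))

end Entropy

/-- A robust `T`-private information retrieval scheme with `K` messages over the finite
alphabet `𝓦` (so each message has size `log₂ |𝓦|` bits) and `M` databases, such that the answers
of any `N` of the databases suffice to decode. -/
structure RobustScheme (K M N T : ℕ) (𝓦 : Type) [Fintype 𝓦] where
  /-- The underlying probability space. -/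
  Ω : Type
  [measurableSpaceΩ : MeasurableSpace Ω]
  μ : Measure Ω
  [isProbabilityMeasure : IsProbabilityMeasure μ]
  /-- A finite alphabet containing all queries, and one containing all answering strings. -/
  𝒬 : Type
  [fintype𝒬 : Fintype 𝒬]
  𝒜 : Type
  [fintype𝒜 : Fintype 𝒜]
  /-- `W k` is the `k`-th message. -/
  W : Fin K → Ω → 𝓦
  /-- `Q k n` is the query sent to database `n` when message `k` is desired. -/
  Q : Fin K → Fin M → Ω → 𝒬
  /-- `ans n q w` is the answer of database `n` to the query `q` when the stored messages are `w`.
  The database is not told which message is desired, so `ans` does not depend on it. -/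
  ans : Fin M → 𝒬 → (Fin K → 𝓦) → 𝒜
  measurable_W : ∀ k w, MeasurableSet (W k ⁻¹' {w})
  measurable_Q : ∀ k n q, MeasurableSet (Q k n ⁻¹' {q})
  /-- The messages are independent: `H(W₁, …, W_K) = H(W₁) + ⋯ + H(W_K)`. -/
  messages_indep : entropy μ (fun ω k => W k ω) = ∑ k, entropy μ (W k)
  /-- Each message has entropy equal to its size: `H(W_k) = log₂ |𝓦|`. -/
  messages_entropy : ∀ k, entropy μ (W k) = Real.logb 2 (Fintype.card 𝓦)
  /-- The queries are generated without knowledge of the messages: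
  `I(W₁, …, W_K; Q₁^[k], …, Q_M^[k]) = 0`. -/
  queries_indep : ∀ k, mutualInfo μ (fun ω j => W j ω) (fun ω n => Q k n ω) = 0
  /-- Correctness: for every set `𝒩` of `N` databases,
  `H(W_k | A_𝒩^[k], Q₁^[k], …, Q_M^[k]) = 0`. -/
  correct : ∀ (k : Fin K) (𝒩 : Finset (Fin M)), 𝒩.card = N →
    condEntropy μ (W k)
      (fun ω => ((fun n : 𝒩 => ans n (Q k n ω) (fun j => W j ω)), (fun n => Q k n ω))) = 0
  /-- `T`-privacy: for every set `𝒯` of `T` databases, the law of the queries `Q_𝒯^[k]` does not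
  depend on the index `k` of the desired message. -/
  isPrivate : ∀ 𝒯 : Finset (Fin M), 𝒯.card = T → ∀ (k k' : Fin K) (q : 𝒯 → 𝒬),
    μ {ω | ∀ n : 𝒯, Q k n ω = q n} = μ {ω | ∀ n : 𝒯, Q k' n ω = q n}

attribute [instance] RobustScheme.measurableSpaceΩ RobustScheme.isProbabilityMeasure
  RobustScheme.fintype𝒬 RobustScheme.fintype𝒜

namespace RobustScheme

variable {K M N T : ℕ} {𝓦 : Type} [Fintype 𝓦]

/-- The answering string `A_n^[k]` of database `n` when message `k` is desired. -/
def A (S : RobustScheme K M N T 𝓦) (k : Fin K) (n : Fin M) (ω : S.Ω) : S.𝒜 :=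
  S.ans n (S.Q k n ω) (fun j => S.W j ω)

/-- The number of desired bits per downloaded bit when message `k` is desired and the set of
responding databases is `𝒩`. -/
noncomputable def rateOn (S : RobustScheme K M N T 𝓦) (k : Fin K) (𝒩 : Finset (Fin M)) : ℝ :=
  Real.logb 2 (Fintype.card 𝓦) / ∑ n ∈ 𝒩, entropy S.μ (S.A k n)

/-- The rate of the scheme: the number of desired bits per downloaded bit that is guaranteed
whichever message is desired and whichever `N` of the databases respond. -/
noncomputable def rate (S : RobustScheme K M N T 𝓦) : ℝ :=
  ⨅ p : Fin K × {𝒩 : Finset (Fin M) // 𝒩.card = N}, S.rateOn p.1 p.2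

end RobustScheme

/-- `C` is the capacity of robust `T`-private information retrieval: the supremum of the rates of
all schemes whose messages consist of `L` bits each, for arbitrary message size `L`. -/
def IsCapacity (K M N T : ℕ) (C : ℝ) : Prop :=
  IsLUB {R : ℝ | ∃ L : ℕ, 0 < L ∧ ∃ S : RobustScheme K M N T (Fin L → Bool), R = S.rate} C

end PIR

/-! Converse. The messages are uniform and independent of the queries, so for each fixed query
vector the answers are functions of a uniform message tuple. Let h_k(J) be the entropy of the
answers from 𝒩 given the queries and the messages in J, when message k is desired. Decodability
gives h_k(J) = log |𝓦| + h_k(J ∪ {k}) for k ∉ J (`condAnswerEntropy_eq_log_add`). No T databases can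
tell k from k', and by Han's inequality the T-subsets of 𝒩 carry on average at least T/N of the
entropy, so h_k(J) ≥ (T/N) h_{k'}(J) (`mul_condAnswerEntropy_le`). Alternating the two through all K
messages produces the geometric sum, and h_k(∅) is at most the sum of the single answer entropies.

Achievability. Messages are linear functionals on F^(N^K). For every nonempty set B of messages,
each database returns (N-T)^(|B|-1) T^(K-|B|) sums of one evaluation of each message in B. The
arguments are code vectors moved by a secret uniform automorphism per message, so only linear
relations among them can leak. For k ∉ B, the interfering messages use one Reed–Solomon code for
both B and B ∪ {k}. Its dimension is the number of B-sums from N databases, so these determine the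
interference and remove it from the sums over B ∪ {k}; it is also the number of its vectors seen by
T databases, which are therefore independent (`mul_blockSize`). -/

namespace PIR

/-! ### Han's inequality. -/

section Counting

open Finset

/-- Han's inequality: a submodular set function averages over the `(m + 1)`-subsets of `𝒩` to at
least `(m + 1) / |𝒩|` times its value at `𝒩`. -/
theorem le_sum_powersetCard_of_submodular {ι : Type*} [LinearOrder ι] (f : Finset ι → ℝ)
    (h0 : f ∅ = 0)
    (hsub : ∀ (s t : Finset ι) (a : ι), s ⊆ t → a ∉ t → f (insert a t) + f s ≤ f (insert a s) + f t)
    (𝒩 : Finset ι) (m : ℕ) :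
    ((#𝒩 - 1).choose m : ℝ) * f 𝒩 ≤ ∑ 𝒯 ∈ 𝒩.powersetCard (m + 1), f 𝒯 := by
  -- The increments of `f` as `𝒩` is exhausted in increasing order. They add up to `f` on initial
  -- segments; on other subsets submodularity gives only a lower bound for `f`.
  set g : ι → ℝ := fun a => f (insert a (𝒩.filter (· < a))) - f (𝒩.filter (· < a)) with hg
  have hlow : ∀ 𝒯 : Finset ι, 𝒯 ⊆ 𝒩 → ∑ a ∈ 𝒯, g a ≤ f 𝒯 := by
    intro 𝒯
    induction 𝒯 using Finset.induction_on_max with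
    | empty => simp [h0]
    | insert a s ha ih =>
      intro hs
      have has : a ∉ s := fun h => lt_irrefl _ (ha a h)
      rw [sum_insert has]
      have h1 := ih ((subset_insert _ _).trans hs)
      have h2 := hsub s (𝒩.filter (· < a)) a
        (fun x hx => mem_filter.2 ⟨hs (mem_insert_of_mem hx), ha x hx⟩) (by simp)
      simp only [hg] at h1 ⊢
      linarith
  have hfull : ∀ 𝒯 : Finset ι, (∀ a ∈ 𝒯, ∀ b ∈ 𝒩, b < a → b ∈ 𝒯) → 𝒯 ⊆ 𝒩 → ∑ a ∈ 𝒯, g a = f 𝒯 := by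
    intro 𝒯
    induction 𝒯 using Finset.induction_on_max with
    | empty => simp [h0]
    | insert a s ha ih =>
      intro hc hs
      have has : a ∉ s := fun h => lt_irrefl _ (ha a h)
      have hsa : 𝒩.filter (· < a) = s := by
        ext x
        simp only [mem_filter]
        constructor
        · rintro ⟨hx, hxa⟩
          exact (mem_insert.1 (hc a (mem_insert_self _ _) x hx hxa)).resolve_left hxa.ne
        · intro hx
          exact ⟨hs (mem_insert_of_mem hx), ha x hx⟩
      rw [sum_insert has, ih _ ((subset_insert _ _).trans hs)]
      · simp only [hg, hsa]; ring
      · intro b hb c hc' hcb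
        refine (mem_insert.1 (hc b (mem_insert_of_mem hb) c hc' hcb)).resolve_left ?_
        rintro rfl
        exact lt_asymm hcb (ha b hb)
  calc ((#𝒩 - 1).choose m : ℝ) * f 𝒩 = ∑ a ∈ 𝒩, ((#𝒩 - 1).choose m : ℝ) * g a := by
        rw [← mul_sum, hfull 𝒩 (fun _ _ b hb _ => hb) subset_rfl]
    -- Each element of `𝒩` lies in (#𝒩 - 1).choose m subsets of size m + 1.
    _ = ∑ a ∈ 𝒩, ∑ 𝒯 ∈ 𝒩.powersetCard (m + 1) with a ∈ 𝒯, g a := by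
        refine sum_congr rfl fun a ha => ?_
        rw [sum_const, nsmul_eq_mul]
        congr 2
        rw [← card_erase_of_mem ha, ← card_powersetCard]
        refine card_bij' (fun s _ => insert a s) (fun s _ => s.erase a) ?_ ?_ ?_ ?_
        · intro s hs
          obtain ⟨h1, h2⟩ := mem_powersetCard.1 hs
          have : a ∉ s := fun h => by simpa using h1 h
          simp only [mem_filter, mem_powersetCard, mem_insert, true_or, and_true]
          refine ⟨insert_subset ha (h1.trans (erase_subset _ _)), ?_⟩
          rw [card_insert_of_notMem this, h2]
        · intro s hs
          simp only [mem_filter, mem_powersetCard] at hs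
          rw [mem_powersetCard]
          exact ⟨erase_subset_erase _ hs.1.1, by rw [card_erase_of_mem hs.2, hs.1.2]; rfl⟩
        · intro s hs
          refine erase_insert fun h => ?_
          simpa using (mem_powersetCard.1 hs).1 h
        · intro s hs
          exact insert_erase (mem_filter.1 hs).2
    _ = ∑ 𝒯 ∈ 𝒩.powersetCard (m + 1), ∑ a ∈ 𝒯, g a := by
        refine sum_comm' fun a s => ?_
        simp only [mem_filter, mem_powersetCard]
        constructor
        · rintro ⟨h1, h2, h3⟩; exact ⟨h3, h2⟩
        · rintro ⟨h3, h2⟩; exact ⟨h2.1 h3, h2, h3⟩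
    _ ≤ _ := sum_le_sum fun 𝒯 h𝒯 => hlow 𝒯 (mem_powersetCard.1 h𝒯).1

/-! ### Entropy of partitions of a finite set. -/

variable {V : Type*} [Fintype V]

open Classical in
/-- The number of elements equivalent to `v`. -/
noncomputable def classCard (r : Setoid V) (v : V) : ℕ := #{u | r u v}

theorem classCard_pos (r : Setoid V) (v : V) : 0 < classCard r v :=
  card_pos.2 ⟨v, by simp⟩

theorem classCard_mono {r s : Setoid V} (h : r ≤ s) (v : V) : classCard r v ≤ classCard s v :=
  card_le_card fun u => by simpa using @h u v

theorem classCard_congr {r : Setoid V} {u v : V} (h : r u v) : classCard r u = classCard r v := by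
  unfold classCard
  congr 1
  ext w
  simp only [mem_filter, mem_univ, true_and]
  exact ⟨fun h' => r.trans h' h, fun h' => r.trans h' (r.symm h)⟩

/-- Entropy, in nats, of the class of a uniform element of `V`, up to the constant `log |V|`. -/
noncomputable def negLogClass (r : Setoid V) : ℝ := -∑ v, Real.log (classCard r v)

open Classical in
-- The numerator counts pairs (u, w) with u related to v by z ⊓ x and w by z ⊓ y. For a fixed pair,
-- all such v lie in a single class of z ⊓ x ⊓ y, so their weights sum to at most 1 / `classCard z
-- u`; summing over w in the z-class of u leaves at most 1 for each u.
theorem sum_ratio_classCard_le (z x y : Setoid V) :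
    ∑ v, ((classCard (z ⊓ x) v : ℝ) * classCard (z ⊓ y) v) /
      (classCard (z ⊓ x ⊓ y) v * classCard z v) ≤ Fintype.card V := by
  have key : ∀ v : V, ((classCard (z ⊓ x) v : ℝ) * classCard (z ⊓ y) v) /
      (classCard (z ⊓ x ⊓ y) v * classCard z v) =
      ∑ u : V, ∑ w : V, if (z ⊓ x) u v ∧ (z ⊓ y) w v then
        ((classCard (z ⊓ x ⊓ y) v : ℝ) * classCard z v)⁻¹ else 0 := by
    intro v
    have h1 : (classCard (z ⊓ x) v : ℝ) = ∑ u : V, if (z ⊓ x) u v then 1 else 0 := by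
      simp [classCard]
    have h2 : (classCard (z ⊓ y) v : ℝ) = ∑ u : V, if (z ⊓ y) u v then 1 else 0 := by
      simp [classCard]
    rw [h1, h2, sum_mul_sum, div_eq_mul_inv, sum_mul]
    refine sum_congr rfl fun u _ => ?_
    rw [sum_mul]
    refine sum_congr rfl fun w _ => ?_
    split_ifs <;> simp_all
  have inner : ∀ u w : V, (∑ v : V, if (z ⊓ x) u v ∧ (z ⊓ y) w v then
        ((classCard (z ⊓ x ⊓ y) v : ℝ) * classCard z v)⁻¹ else 0) ≤
        if z w u then (classCard z u : ℝ)⁻¹ else 0 := by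
    intro u w
    rw [← sum_filter]
    by_cases hne : (univ.filter fun v => (z ⊓ x) u v ∧ (z ⊓ y) w v).Nonempty
    · obtain ⟨v₀, hv₀⟩ := hne
      simp only [mem_filter, mem_univ, true_and] at hv₀
      have hzu : z w u := z.trans hv₀.2.1 (z.symm hv₀.1.1)
      rw [if_pos hzu]
      have hpos : (0 : ℝ) < classCard (z ⊓ x ⊓ y) v₀ := by exact_mod_cast classCard_pos _ _
      calc _ ≤ ∑ v with (z ⊓ x ⊓ y) v v₀,
              ((classCard (z ⊓ x ⊓ y) v₀ : ℝ) * classCard z u)⁻¹ := by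
            have hsubset : (univ.filter fun v => (z ⊓ x) u v ∧ (z ⊓ y) w v) ⊆
                univ.filter fun v => (z ⊓ x ⊓ y) v v₀ := by
              intro v hv
              simp only [mem_filter, mem_univ, true_and] at hv ⊢
              exact ⟨(z ⊓ x).trans ((z ⊓ x).symm hv.1) hv₀.1,
                y.trans (y.symm hv.2.2) hv₀.2.2⟩
            refine (sum_le_sum_of_subset_of_nonneg hsubset fun _ _ _ => by positivity).trans
              (sum_le_sum fun v hv => ?_)
            simp only [mem_filter, mem_univ, true_and] at hv
            rw [classCard_congr hv, classCard_congr (z.trans hv.1.1 (z.symm hv₀.1.1))]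
        _ = (classCard z u : ℝ)⁻¹ := by
            rw [sum_const, nsmul_eq_mul, mul_inv]
            change (classCard (z ⊓ x ⊓ y) v₀ : ℝ) * _ = _
            rw [← mul_assoc, mul_inv_cancel₀ hpos.ne', one_mul]
    · rw [not_nonempty_iff_eq_empty.1 hne, sum_empty]
      split_ifs <;> positivity
  calc _ = ∑ u : V, ∑ w : V, ∑ v : V, if (z ⊓ x) u v ∧ (z ⊓ y) w v then
        ((classCard (z ⊓ x ⊓ y) v : ℝ) * classCard z v)⁻¹ else 0 := by
        rw [sum_congr rfl fun v _ => key v, sum_comm]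
        exact sum_congr rfl fun u _ => sum_comm
    _ ≤ ∑ u : V, ∑ w : V, if z w u then (classCard z u : ℝ)⁻¹ else 0 :=
        sum_le_sum fun u _ => sum_le_sum fun w _ => inner u w
    _ = ∑ u : V, (1 : ℝ) := by
        refine sum_congr rfl fun u _ => ?_
        rw [← sum_filter, sum_const, nsmul_eq_mul]
        exact mul_inv_cancel₀ (by exact_mod_cast (classCard_pos z u).ne')
    _ = Fintype.card V := by simp

/-- Submodularity of Shannon entropy, for functions of a uniform variable. -/
theorem negLogClass_submodular (z x y : Setoid V) :
    negLogClass (z ⊓ x ⊓ y) + negLogClass z ≤ negLogClass (z ⊓ x) + negLogClass (z ⊓ y) := by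
  -- The inequality log t ≤ t - 1, applied to the ratio whose sum is bounded above.
  have hterm : ∀ v : V, Real.log (classCard (z ⊓ x) v) + Real.log (classCard (z ⊓ y) v) -
      (Real.log (classCard (z ⊓ x ⊓ y) v) + Real.log (classCard z v)) ≤
      ((classCard (z ⊓ x) v : ℝ) * classCard (z ⊓ y) v) /
        (classCard (z ⊓ x ⊓ y) v * classCard z v) - 1 := by
    intro v
    have hp : ∀ r : Setoid V, (0 : ℝ) < classCard r v := fun r => by
      exact_mod_cast classCard_pos r v
    have h1 := hp (z ⊓ x); have h2 := hp (z ⊓ y); have h3 := hp (z ⊓ x ⊓ y); have h4 := hp z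
    rw [← Real.log_mul h1.ne' h2.ne', ← Real.log_mul h3.ne' h4.ne',
      ← Real.log_div (by positivity) (by positivity)]
    exact Real.log_le_sub_one_of_pos (by positivity)
  have hsum := sum_le_sum fun v (_ : v ∈ univ) => hterm v
  simp only [sum_sub_distrib, sum_add_distrib, sum_const, card_univ, nsmul_eq_mul, mul_one] at hsum
  have := sum_ratio_classCard_le z x y
  simp only [negLogClass]
  linarith

theorem negLogClass_anti {r s : Setoid V} (h : r ≤ s) : negLogClass s ≤ negLogClass r := by
  refine neg_le_neg (sum_le_sum fun v _ => Real.log_le_log ?_ ?_)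
  · exact_mod_cast classCard_pos r v
  · exact_mod_cast classCard_mono h v

end Counting

end PIR

namespace PIR

/-! ### From entropy identities to statements about laws. -/

section Probability

open Finset

/-- The equality case of Gibbs' inequality. -/
theorem eq_of_sum_neg_mul_log_le {α : Type*} [Fintype α] {p q : α → ℝ} (hp : ∀ x, 0 ≤ p x)
    (hq : ∀ x, 0 ≤ q x) (hac : ∀ x, q x = 0 → p x = 0) (hsum : ∑ x, q x ≤ ∑ x, p x)
    (h : ∑ x, -(p x * Real.log (q x)) ≤ ∑ x, Real.negMulLog (p x)) : p = q := by
  -- Since `klFun t` = t log t + 1 - t, the summands of the divergence become nonnegative one by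
  -- one, so a vanishing total forces p / q = 1 wherever q > 0.
  have hterm : ∀ x, q x * InformationTheory.klFun (p x / q x) =
      -(p x * Real.log (q x)) - Real.negMulLog (p x) + q x - p x := by
    intro x
    rcases (hq x).eq_or_lt with h0 | hpos
    · simp [← h0, hac x h0.symm]
    · rw [InformationTheory.klFun_apply, Real.negMulLog]
      rcases (hp x).eq_or_lt with h0' | hpos'
      · simp [← h0']
      · rw [Real.log_div hpos'.ne' hpos.ne']
        field_simp
        ring
  have hnn : ∀ x ∈ univ, 0 ≤ q x * InformationTheory.klFun (p x / q x) := fun x _ =>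
    mul_nonneg (hq x) (InformationTheory.klFun_nonneg (div_nonneg (hp x) (hq x)))
  have hzero : ∑ x, q x * InformationTheory.klFun (p x / q x) = 0 := by
    refine le_antisymm ?_ (sum_nonneg hnn)
    rw [sum_congr rfl fun x _ => hterm x]
    simp only [sum_sub_distrib, sum_add_distrib]
    linarith
  funext x
  rcases (hq x).eq_or_lt with h0 | hpos
  · rw [hac x h0.symm, ← h0]
  · have h1 := (sum_eq_zero_iff_of_nonneg hnn).1 hzero x (mem_univ x)
    have h2 := (InformationTheory.klFun_eq_zero_iff (div_nonneg (hp x) (hq x))).1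
      ((mul_eq_zero.1 h1).resolve_left hpos.ne')
    exact (div_eq_one_iff_eq hpos.ne').1 h2

variable {Ω : Type} [MeasurableSpace Ω] {μ : Measure Ω}
variable {α β : Type} [Fintype α] [Fintype β]

theorem measurableSet_preimage_of_fintype {X : Ω → α} (hX : ∀ x, MeasurableSet (X ⁻¹' {x}))
    (s : Set α) : MeasurableSet (X ⁻¹' s) := by
  rw [← Set.biUnion_preimage_singleton]
  exact MeasurableSet.biUnion s.toFinite.countable fun x _ => hX x

omit [Fintype α] [Fintype β] in
theorem measurableSet_preimage_prodMk {X : Ω → α} {Y : Ω → β}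
    (hX : ∀ x, MeasurableSet (X ⁻¹' {x})) (hY : ∀ y, MeasurableSet (Y ⁻¹' {y})) (z : α × β) :
    MeasurableSet ((fun ω => (X ω, Y ω)) ⁻¹' {z}) := by
  have : (fun ω => (X ω, Y ω)) ⁻¹' {z} = X ⁻¹' {z.1} ∩ Y ⁻¹' {z.2} := by
    ext ω; simp [Prod.ext_iff]
  rw [this]
  exact (hX _).inter (hY _)

omit [Fintype α] in
theorem measurableSet_preimage_pi {ι : Type*} [Fintype ι] {X : ι → Ω → α}
    (hX : ∀ i x, MeasurableSet (X i ⁻¹' {x})) (z : ι → α) :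
    MeasurableSet ((fun ω i => X i ω) ⁻¹' {z}) := by
  have : (fun ω i => X i ω) ⁻¹' {z} = ⋂ i, X i ⁻¹' {z i} := by
    ext ω; simp [funext_iff]
  rw [this]
  exact MeasurableSet.iInter fun i => hX i _

open Classical in
/-- The law of a function of a finite-valued random variable. -/
theorem measureReal_setOf_eq_sum [IsFiniteMeasure μ] {X : Ω → α}
    (hX : ∀ x, MeasurableSet (X ⁻¹' {x})) (P : α → Prop) :
    μ.real {ω | P (X ω)} = ∑ x, if P x then μ.real (X ⁻¹' {x}) else 0 := by
  rw [← sum_filter, sum_measureReal_preimage_singleton _ fun x _ => hX x]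
  congr 1
  ext ω
  simp

theorem sum_measureReal_fiber [IsProbabilityMeasure μ] {X : Ω → α}
    (hX : ∀ x, MeasurableSet (X ⁻¹' {x})) : ∑ x, μ.real (X ⁻¹' {x}) = 1 := by
  rw [sum_measureReal_preimage_singleton _ fun x _ => hX x]
  simp

theorem sum_measureReal_fiber_prodMk_right [IsFiniteMeasure μ] {X : Ω → α} {Y : Ω → β}
    (hX : ∀ x, MeasurableSet (X ⁻¹' {x})) (hY : ∀ y, MeasurableSet (Y ⁻¹' {y})) (x : α) :
    ∑ y, μ.real ((fun ω => (X ω, Y ω)) ⁻¹' {(x, y)}) = μ.real (X ⁻¹' {x}) := by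
  classical
  have h := measureReal_setOf_eq_sum (μ := μ) (measurableSet_preimage_prodMk hX hY)
    (fun z => z.1 = x)
  rw [Fintype.sum_prod_type, sum_eq_single x] at h
  · simp only [if_true] at h; exact h.symm
  · intro b _ hb; simp [hb]
  · simp

theorem sum_measureReal_fiber_prodMk_left [IsFiniteMeasure μ] {X : Ω → α} {Y : Ω → β}
    (hX : ∀ x, MeasurableSet (X ⁻¹' {x})) (hY : ∀ y, MeasurableSet (Y ⁻¹' {y})) (y : β) :
    ∑ x, μ.real ((fun ω => (X ω, Y ω)) ⁻¹' {(x, y)}) = μ.real (Y ⁻¹' {y}) := by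
  classical
  have h := measureReal_setOf_eq_sum (μ := μ) (measurableSet_preimage_prodMk hX hY)
    (fun z => z.2 = y)
  rw [Fintype.sum_prod_type_right, sum_eq_single y] at h
  · simp only [if_true] at h; exact h.symm
  · intro b _ hb; simp [hb]
  · simp

theorem entropy_mul_log_two (X : Ω → α) :
    entropy μ X * Real.log 2 = ∑ x, Real.negMulLog (μ.real (X ⁻¹' {x})) := by
  rw [entropy, ← sum_div, div_mul_cancel₀ _ (Real.log_pos one_lt_two).ne']

/-- A random variable with maximal entropy is uniform. -/
theorem measureReal_fiber_of_entropy_eq [IsProbabilityMeasure μ] {X : Ω → α}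
    (hX : ∀ x, MeasurableSet (X ⁻¹' {x})) (h : entropy μ X = Real.logb 2 (Fintype.card α)) (x : α) :
    μ.real (X ⁻¹' {x}) = (Fintype.card α : ℝ)⁻¹ := by
  have hc : (Fintype.card α : ℝ) ≠ 0 := by
    have : Nonempty α := ⟨x⟩
    exact_mod_cast Fintype.card_ne_zero
  have hs := sum_measureReal_fiber (μ := μ) hX
  refine congrFun (eq_of_sum_neg_mul_log_le (p := fun x => μ.real (X ⁻¹' {x}))
    (q := fun _ => (Fintype.card α : ℝ)⁻¹) (fun _ => measureReal_nonneg) (fun _ => by positivity)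
    (fun _ h0 => absurd h0 (inv_ne_zero hc)) ?_ ?_) x
  · rw [hs]; simp [hc]
  · rw [← entropy_mul_log_two, h, sum_neg_distrib, ← sum_mul, hs, Real.log_inv, Real.logb,
      div_mul_cancel₀ _ (Real.log_pos one_lt_two).ne']
    simp

/-- Random variables without mutual information are independent. -/
theorem measureReal_fiber_of_mutualInfo_eq_zero [IsProbabilityMeasure μ] {X : Ω → α} {Y : Ω → β}
    (hX : ∀ x, MeasurableSet (X ⁻¹' {x})) (hY : ∀ y, MeasurableSet (Y ⁻¹' {y}))
    (h : mutualInfo μ X Y = 0) (x : α) (y : β) :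
    μ.real ((fun ω => (X ω, Y ω)) ⁻¹' {(x, y)}) = μ.real (X ⁻¹' {x}) * μ.real (Y ⁻¹' {y}) := by
  have hXs := sum_measureReal_fiber (μ := μ) hX
  have hYs := sum_measureReal_fiber (μ := μ) hY
  have hr := sum_measureReal_fiber_prodMk_right (μ := μ) hX hY
  have hl := sum_measureReal_fiber_prodMk_left (μ := μ) hX hY
  have hlex : ∀ z : α × β, μ.real ((fun ω => (X ω, Y ω)) ⁻¹' {z}) ≤ μ.real (X ⁻¹' {z.1}) :=
    fun z => measureReal_mono (fun ω hω => by
      simp only [Set.mem_preimage, Set.mem_singleton_iff] at hω ⊢; rw [← hω])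
  have hley : ∀ z : α × β, μ.real ((fun ω => (X ω, Y ω)) ⁻¹' {z}) ≤ μ.real (Y ⁻¹' {z.2}) :=
    fun z => measureReal_mono (fun ω hω => by
      simp only [Set.mem_preimage, Set.mem_singleton_iff] at hω ⊢; rw [← hω])
  refine congrFun (eq_of_sum_neg_mul_log_le
    (p := fun z : α × β => μ.real ((fun ω => (X ω, Y ω)) ⁻¹' {z}))
    (q := fun z => μ.real (X ⁻¹' {z.1}) * μ.real (Y ⁻¹' {z.2})) (fun _ => measureReal_nonneg)
    (fun _ => by positivity) ?_ ?_ ?_) (x, y)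
  · intro z hz
    refine le_antisymm ?_ measureReal_nonneg
    rcases mul_eq_zero.1 hz with h0 | h0
    · exact (hlex z).trans h0.le
    · exact (hley z).trans h0.le
  · rw [sum_measureReal_fiber (measurableSet_preimage_prodMk hX hY), Fintype.sum_prod_type]
    simp only [← mul_sum, hYs, mul_one, hXs, le_refl]
  · have h' : entropy μ (fun ω => (X ω, Y ω)) * Real.log 2 =
        entropy μ X * Real.log 2 + entropy μ Y * Real.log 2 := by
      rw [← add_mul]; congr 1; unfold mutualInfo at h; linarith
    rw [entropy_mul_log_two, entropy_mul_log_two, entropy_mul_log_two] at h'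
    rw [h']
    have hsplit : ∀ z : α × β, -(μ.real ((fun ω => (X ω, Y ω)) ⁻¹' {z}) *
        Real.log (μ.real (X ⁻¹' {z.1}) * μ.real (Y ⁻¹' {z.2}))) =
        μ.real ((fun ω => (X ω, Y ω)) ⁻¹' {z}) * -Real.log (μ.real (X ⁻¹' {z.1})) +
        μ.real ((fun ω => (X ω, Y ω)) ⁻¹' {z}) * -Real.log (μ.real (Y ⁻¹' {z.2})) := by
      intro z
      -- The logarithm of a product splits only for nonzero factors; if a marginal vanishes, so does
      -- the joint probability.
      by_cases h1 : μ.real (X ⁻¹' {z.1}) = 0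
      · have := le_antisymm ((hlex z).trans h1.le) measureReal_nonneg
        simp [this]
      by_cases h2 : μ.real (Y ⁻¹' {z.2}) = 0
      · have := le_antisymm ((hley z).trans h2.le) measureReal_nonneg
        simp [this]
      rw [Real.log_mul h1 h2]; ring
    rw [sum_congr rfl fun z _ => hsplit z, sum_add_distrib, Fintype.sum_prod_type,
      Fintype.sum_prod_type_right]
    simp only [← sum_mul, hr, hl, Real.negMulLog]
    simp

/-- If `H(X | Y) = 0` then each atom of `Y` is contained in an atom of `X`. -/
theorem measureReal_fiber_of_condEntropy_eq_zero [IsFiniteMeasure μ] {X : Ω → α} {Y : Ω → β}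
    (hX : ∀ x, MeasurableSet (X ⁻¹' {x})) (hY : ∀ y, MeasurableSet (Y ⁻¹' {y}))
    (h : condEntropy μ X Y = 0) (x : α) (y : β) :
    μ.real ((fun ω => (X ω, Y ω)) ⁻¹' {(x, y)}) = 0 ∨
      μ.real ((fun ω => (X ω, Y ω)) ⁻¹' {(x, y)}) = μ.real (Y ⁻¹' {y}) := by
  have hl := sum_measureReal_fiber_prodMk_left (μ := μ) hX hY
  have hley : ∀ z : α × β, μ.real ((fun ω => (X ω, Y ω)) ⁻¹' {z}) ≤ μ.real (Y ⁻¹' {z.2}) :=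
    fun z => measureReal_mono (fun ω hω => by
      simp only [Set.mem_preimage, Set.mem_singleton_iff] at hω ⊢; rw [← hω])
  -- H(X | Y) as the sum of p(x, y) log (p(y) / p(x, y)), whose terms are all nonnegative.
  have h' : ∑ z : α × β, μ.real ((fun ω => (X ω, Y ω)) ⁻¹' {z}) *
      (Real.log (μ.real (Y ⁻¹' {z.2})) - Real.log (μ.real ((fun ω => (X ω, Y ω)) ⁻¹' {z}))) = 0 := by
    have h1 : entropy μ (fun ω => (X ω, Y ω)) * Real.log 2 = entropy μ Y * Real.log 2 := by
      congr 1; unfold condEntropy at h; linarith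
    rw [entropy_mul_log_two, entropy_mul_log_two] at h1
    simp only [mul_sub, sum_sub_distrib]
    simp only [Real.negMulLog, neg_mul, sum_neg_distrib, neg_inj] at h1
    rw [h1, Fintype.sum_prod_type_right, sub_eq_zero]
    simp only [← sum_mul, hl]
  have hnn : ∀ z ∈ (univ : Finset (α × β)), 0 ≤ μ.real ((fun ω => (X ω, Y ω)) ⁻¹' {z}) *
      (Real.log (μ.real (Y ⁻¹' {z.2})) -
        Real.log (μ.real ((fun ω => (X ω, Y ω)) ⁻¹' {z}))) := by
    intro z _
    rcases (measureReal_nonneg (μ := μ) (s := (fun ω => (X ω, Y ω)) ⁻¹' {z})).eq_or_lt with h0 | h0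
    · simp [← h0]
    · exact mul_nonneg h0.le (sub_nonneg.2 (Real.log_le_log h0 (hley z)))
  have h0 := (sum_eq_zero_iff_of_nonneg hnn).1 h' (x, y) (mem_univ _)
  rcases mul_eq_zero.1 h0 with h0 | h0
  · exact Or.inl h0
  · rcases (measureReal_nonneg (μ := μ)
      (s := (fun ω => (X ω, Y ω)) ⁻¹' {(x, y)})).eq_or_lt with h1 | h1
    · exact Or.inl h1.symm
    · exact Or.inr (Real.log_injOn_pos h1 (h1.trans_le (hley (x, y))) (sub_eq_zero.1 h0).symm)

end Probability

end PIR

namespace PIR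

/-! ### Entropy of the answers for a fixed query. -/

section ConditionalAnswers

open Finset

variable {κ ι 𝓦 𝒜 : Type*} [Fintype κ] [DecidableEq κ] [Fintype 𝓦]

/-- Message tuples agree on the messages in `J` and on the answers in `𝒯`. -/
def agree (a : ι → (κ → 𝓦) → 𝒜) (J : Finset κ) (𝒯 : Finset ι) : Setoid (κ → 𝓦) where
  r u v := (∀ j ∈ J, u j = v j) ∧ ∀ n ∈ 𝒯, a n u = a n v
  iseqv := ⟨fun _ => ⟨fun _ _ => rfl, fun _ _ => rfl⟩,
    fun h => ⟨fun j hj => (h.1 j hj).symm, fun n hn => (h.2 n hn).symm⟩,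
    fun h h' => ⟨fun j hj => (h.1 j hj).trans (h'.1 j hj),
      fun n hn => (h.2 n hn).trans (h'.2 n hn)⟩⟩

omit [Fintype κ] [DecidableEq κ] [Fintype 𝓦] in
theorem agree_iff {a : ι → (κ → 𝓦) → 𝒜} {J : Finset κ} {𝒯 : Finset ι} {u v : κ → 𝓦} :
    agree a J 𝒯 u v ↔ (∀ j ∈ J, u j = v j) ∧ ∀ n ∈ 𝒯, a n u = a n v := Iff.rfl

/-- The entropy, in nats, of the answers in `𝒯` conditioned on the messages in `J`, for uniform
messages. -/
noncomputable def answerEntropy (a : ι → (κ → 𝓦) → 𝒜) (J : Finset κ) (𝒯 : Finset ι) : ℝ :=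
  (negLogClass (agree a J 𝒯) - negLogClass (agree a J ∅)) / Fintype.card (κ → 𝓦)

omit [DecidableEq κ] [Fintype κ] [Fintype 𝓦] in
theorem agree_congr {a b : ι → (κ → 𝓦) → 𝒜} {J : Finset κ} {𝒯 : Finset ι}
    (h : ∀ n ∈ 𝒯, a n = b n) : agree a J 𝒯 = agree b J 𝒯 := by
  ext u v
  exact and_congr_right fun _ => forall₂_congr fun n hn => by rw [h n hn]

theorem answerEntropy_congr {a b : ι → (κ → 𝓦) → 𝒜} {J : Finset κ} {𝒯 : Finset ι}
    (h : ∀ n ∈ 𝒯, a n = b n) : answerEntropy a J 𝒯 = answerEntropy b J 𝒯 := by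
  unfold answerEntropy
  rw [agree_congr h, agree_congr (a := a) (b := b) (𝒯 := ∅) (by simp)]

theorem answerEntropy_empty (a : ι → (κ → 𝓦) → 𝒜) (J : Finset κ) : answerEntropy a J ∅ = 0 := by
  simp [answerEntropy]

theorem answerEntropy_mono (a : ι → (κ → 𝓦) → 𝒜) (J : Finset κ) {s t : Finset ι} (h : s ⊆ t) :
    answerEntropy a J s ≤ answerEntropy a J t := by
  refine div_le_div_of_nonneg_right (sub_le_sub_right (negLogClass_anti ?_) _) (by positivity)
  exact fun u v huv => ⟨huv.1, fun n hn => huv.2 n (h hn)⟩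

theorem answerEntropy_nonneg (a : ι → (κ → 𝓦) → 𝒜) (J : Finset κ) (s : Finset ι) :
    0 ≤ answerEntropy a J s :=
  (answerEntropy_empty a J).ge.trans (answerEntropy_mono a J (empty_subset s))

/-- Agreement on a union of sets of databases is the meet of the agreement relations, so this is
submodularity for partitions. -/
theorem answerEntropy_submodular [DecidableEq ι] (a : ι → (κ → 𝓦) → 𝒜) (J : Finset κ)
    {s t : Finset ι} (n : ι) (h : s ⊆ t) :
    answerEntropy a J (insert n t) + answerEntropy a J s ≤
      answerEntropy a J (insert n s) + answerEntropy a J t := by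
  have hins : ∀ s : Finset ι, agree a J s ⊓ agree a J {n} = agree a J (insert n s) := by
    intro s
    ext u v
    simp only [Setoid.inf_def, Pi.inf_apply, inf_Prop_eq, agree_iff, mem_singleton, forall_eq,
      mem_insert, forall_eq_or_imp]
    tauto
  have hst : agree a J s ⊓ agree a J t = agree a J t :=
    inf_eq_right.2 fun u v huv => ⟨huv.1, fun n hn => huv.2 n (h hn)⟩
  have key := negLogClass_submodular (agree a J s) (agree a J t) (agree a J {n})
  rw [hst, hins, hins] at key
  unfold answerEntropy
  rw [← add_div, ← add_div]
  exact div_le_div_of_nonneg_right (by linarith) (by positivity)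

theorem classCard_agree_empty (a : ι → (κ → 𝓦) → 𝒜) (J : Finset κ) (v : κ → 𝓦) :
    classCard (agree a J ∅) v = Fintype.card 𝓦 ^ #Jᶜ := by
  classical
  have : ({u | agree a J ∅ u v} : Finset (κ → 𝓦)) =
      Fintype.piFinset fun j => if j ∈ J then {v j} else univ := by
    ext u
    simp only [mem_filter, mem_univ, true_and, Fintype.mem_piFinset]
    constructor
    · intro h j
      split_ifs with hj
      · exact mem_singleton.2 (h.1 j hj)
      · exact mem_univ _
    · intro h
      refine ⟨fun j hj => ?_, by simp⟩
      simpa [hj] using h j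
  unfold classCard
  rw [filter_congr_decidable, this, Fintype.card_piFinset, ← prod_mul_prod_compl J,
    prod_eq_one fun j hj => by simp [hj], one_mul,
    prod_congr rfl fun j hj => by rw [if_neg (mem_compl.1 hj), card_univ], prod_const]

/-- If the answers in `𝒩` determine message `k`, they carry its entropy. -/
theorem answerEntropy_eq_log_add [Nonempty 𝓦] (a : ι → (κ → 𝓦) → 𝒜) {J : Finset κ}
    {𝒩 : Finset ι} {k : κ} (hk : k ∉ J)
    (hdec : ∀ u v : κ → 𝓦, (∀ n ∈ 𝒩, a n u = a n v) → u k = v k) :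
    answerEntropy a J 𝒩 = Real.log (Fintype.card 𝓦) + answerEntropy a (insert k J) 𝒩 := by
  -- Agreement of the answers already forces agreement on message k, so only the normalising terms
  -- differ, by one factor |𝓦| in the class size.
  have h1 : agree a (insert k J) 𝒩 = agree a J 𝒩 := by
    ext u v
    constructor
    · exact fun h => ⟨fun j hj => h.1 j (mem_insert_of_mem hj), h.2⟩
    · intro h
      refine ⟨fun j hj => ?_, h.2⟩
      rcases mem_insert.1 hj with rfl | hj
      · exact hdec u v h.2
      · exact h.1 j hj
  have h2 : #Jᶜ = #(insert k J)ᶜ + 1 := by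
    rw [compl_insert, card_erase_add_one (mem_compl.2 hk)]
  have hV : (Fintype.card (κ → 𝓦) : ℝ) ≠ 0 := by exact_mod_cast Fintype.card_ne_zero
  unfold answerEntropy
  rw [h1, negLogClass, negLogClass, negLogClass]
  simp only [classCard_agree_empty, h2, sum_const, card_univ, nsmul_eq_mul, Nat.cast_pow,
    Real.log_pow]
  field_simp
  push_cast
  ring

/-- For uniform messages, the entropy of a single answer is the Shannon entropy of its law. -/
theorem answerEntropy_singleton [Fintype 𝒜] [DecidableEq 𝒜] (a : ι → (κ → 𝓦) → 𝒜) (n : ι) :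
    answerEntropy a ∅ {n} =
      ∑ x, Real.negMulLog (#{w : κ → 𝓦 | a n w = x} / Fintype.card (κ → 𝓦)) := by
  have h1 : ∀ v, classCard (agree a ∅ {n}) v = #{w : κ → 𝓦 | a n w = a n v} := by
    intro v
    unfold classCard
    congr 1
    ext u
    simp [agree_iff]
  have h2 : ∀ v, classCard (agree a ∅ ∅) v = Fintype.card (κ → 𝓦) := by
    intro v
    rw [classCard_agree_empty]; simp
  unfold answerEntropy negLogClass
  simp only [h1, h2]
  rw [← sum_fiberwise univ (a n) fun v => Real.log (#{w : κ → 𝓦 | a n w = a n v} : ℕ),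
    ← sum_fiberwise univ (a n) fun v => Real.log (Fintype.card (κ → 𝓦)), ← sum_neg_distrib,
    ← sum_neg_distrib, ← sum_sub_distrib, sum_div]
  refine sum_congr rfl fun x _ => ?_
  rw [sum_congr rfl fun v hv => by rw [(mem_filter.1 hv).2], sum_const, sum_const, nsmul_eq_mul,
    nsmul_eq_mul]
  rcases Nat.eq_zero_or_pos #{w : κ → 𝓦 | a n w = x} with h0 | hpos
  · simp [h0]
  · have hV : 0 < Fintype.card (κ → 𝓦) := hpos.trans_le (card_le_univ _)
    have hV' : (0 : ℝ) < Fintype.card (κ → 𝓦) := by exact_mod_cast hV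
    have hp' : (0 : ℝ) < #{w : κ → 𝓦 | a n w = x} := by exact_mod_cast hpos
    rw [Real.negMulLog, Real.log_div hp'.ne' hV'.ne']
    field_simp
    ring

end ConditionalAnswers

/-! ### The converse bound. -/

namespace RobustScheme

open Finset

variable {K M N T : ℕ} {𝓦 : Type} [Fintype 𝓦] (S : RobustScheme K M N T 𝓦)

theorem measurable_messages (w : Fin K → 𝓦) :
    MeasurableSet ((fun ω j => S.W j ω) ⁻¹' {w}) := measurableSet_preimage_pi S.measurable_W w

theorem measurable_queries (k : Fin K) (q : Fin M → S.𝒬) :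
    MeasurableSet ((fun ω n => S.Q k n ω) ⁻¹' {q}) := measurableSet_preimage_pi (S.measurable_Q k) q

/-- The law of the queries when message `k` is desired. -/
noncomputable def queryProb (k : Fin K) (q : Fin M → S.𝒬) : ℝ :=
  S.μ.real ((fun ω n => S.Q k n ω) ⁻¹' {q})

theorem queryProb_nonneg (k : Fin K) (q : Fin M → S.𝒬) : 0 ≤ S.queryProb k q :=
  measureReal_nonneg

theorem sum_queryProb (k : Fin K) : ∑ q, S.queryProb k q = 1 :=
  sum_measureReal_fiber (S.measurable_queries k)

/-- The joint entropy is K log₂ |𝓦|, the maximum for K-tuples, so the tuple is uniform. -/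
theorem measureReal_messages (w : Fin K → 𝓦) :
    S.μ.real ((fun ω j => S.W j ω) ⁻¹' {w}) = (Fintype.card (Fin K → 𝓦) : ℝ)⁻¹ := by
  refine measureReal_fiber_of_entropy_eq S.measurable_messages ?_ w
  rw [S.messages_indep, sum_congr rfl fun k _ => S.messages_entropy k]
  simp [Real.logb_pow]

theorem measureReal_messages_queries (k : Fin K) (w : Fin K → 𝓦) (q : Fin M → S.𝒬) :
    S.μ.real ((fun ω => ((fun j => S.W j ω), (fun n => S.Q k n ω))) ⁻¹' {(w, q)}) =
      (Fintype.card (Fin K → 𝓦) : ℝ)⁻¹ * S.queryProb k q := by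
  rw [measureReal_fiber_of_mutualInfo_eq_zero S.measurable_messages (S.measurable_queries k)
    (S.queries_indep k), S.measureReal_messages]
  rfl

theorem nonempty_messages (S : RobustScheme K M N T 𝓦) : Nonempty (Fin K → 𝓦) :=
  (nonempty_of_isProbabilityMeasure S.μ).map fun ω j => S.W j ω

theorem measurable_answer (k : Fin K) (n : Fin M) (x : S.𝒜) : MeasurableSet (S.A k n ⁻¹' {x}) :=
  measurableSet_preimage_of_fintype
    (measurableSet_preimage_prodMk S.measurable_messages (S.measurable_queries k))
    {z : (Fin K → 𝓦) × (Fin M → S.𝒬) | S.ans n (z.2 n) z.1 = x}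

/-- The desired message is a function of any `N` answers, for every query that occurs. -/
theorem decodable {k : Fin K} {𝒩 : Finset (Fin M)} (h𝒩 : #𝒩 = N) {q : Fin M → S.𝒬}
    (hq : 0 < S.queryProb k q) (u v : Fin K → 𝓦)
    (huv : ∀ n ∈ 𝒩, S.ans n (q n) u = S.ans n (q n) v) : u k = v k := by
  have := S.nonempty_messages
  have hcard : (0 : ℝ) < Fintype.card (Fin K → 𝓦) := by exact_mod_cast Fintype.card_pos
  set Y : S.Ω → (𝒩 → S.𝒜) × (Fin M → S.𝒬) := fun ω =>
    ((fun n : 𝒩 => S.ans n (S.Q k n ω) (fun j => S.W j ω)), (fun n => S.Q k n ω)) with hY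
  have hYm : ∀ y, MeasurableSet (Y ⁻¹' {y}) :=
    measurableSet_preimage_prodMk
      (measurableSet_preimage_pi fun n : 𝒩 => S.measurable_answer k n) (S.measurable_queries k)
  -- Every message tuple occurs together with `q`, by uniformity and independence.
  have hpos : ∀ w : Fin K → 𝓦, 0 < S.μ.real ((fun ω => (S.W k ω, Y ω)) ⁻¹'
      {(w k, ((fun n : 𝒩 => S.ans n (q n) w), q))}) := by
    intro w
    have h1 : 0 < S.μ.real
        ((fun ω => ((fun j => S.W j ω), (fun n => S.Q k n ω))) ⁻¹' {(w, q)}) := by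
      rw [S.measureReal_messages_queries]
      positivity
    refine h1.trans_le (measureReal_mono ?_)
    intro ω hω
    simp only [Set.mem_preimage, Set.mem_singleton_iff, Prod.mk.injEq] at hω
    obtain ⟨rfl, rfl⟩ := hω
    rfl
  have hatom : ∀ w : Fin K → 𝓦, S.μ.real ((fun ω => (S.W k ω, Y ω)) ⁻¹'
      {(w k, ((fun n : 𝒩 => S.ans n (q n) w), q))}) =
      S.μ.real (Y ⁻¹' {((fun n : 𝒩 => S.ans n (q n) w), q)}) := fun w =>
    (measureReal_fiber_of_condEntropy_eq_zero (S.measurable_W k) hYm (S.correct k 𝒩 h𝒩)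
      _ _).resolve_left (hpos w).ne'
  have hans : (fun n : 𝒩 => S.ans n (q n) u) = fun n : 𝒩 => S.ans n (q n) v :=
    funext fun n => huv n n.2
  by_contra hne
  -- If u k ≠ v k, two disjoint events would each have the full positive probability of the same
  -- atom of `Y`.
  have hdisj : S.μ.real ((fun ω => (S.W k ω, Y ω)) ⁻¹'
        {(u k, ((fun n : 𝒩 => S.ans n (q n) v), q))} ∪ (fun ω => (S.W k ω, Y ω)) ⁻¹'
        {(v k, ((fun n : 𝒩 => S.ans n (q n) v), q))}) ≤
      S.μ.real (Y ⁻¹' {((fun n : 𝒩 => S.ans n (q n) v), q)}) := by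
    refine measureReal_mono ?_
    rintro ω (hω | hω) <;>
    · simp only [Set.mem_preimage, Set.mem_singleton_iff, Prod.mk.injEq] at hω ⊢
      exact hω.2
  rw [measureReal_union _ (measurableSet_preimage_prodMk (S.measurable_W k) hYm _)] at hdisj
  · have hu := hatom u
    have hu' := hpos u
    rw [hans] at hu hu'
    rw [hu, hatom v] at hdisj
    rw [hu] at hu'
    linarith
  · rw [Set.disjoint_left]
    intro ω h1 h2
    simp only [Set.mem_preimage, Set.mem_singleton_iff, Prod.mk.injEq] at h1 h2
    exact hne (h1.1.symm.trans h2.1)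

/-- Averages over the queries in `𝒯` do not depend on the desired message. -/
theorem sum_queryProb_mul_eq {𝒯 : Finset (Fin M)} (h𝒯 : #𝒯 = T) (k k' : Fin K)
    (F : (Fin M → S.𝒬) → ℝ) (hF : ∀ q q', (∀ n ∈ 𝒯, q n = q' n) → F q = F q') :
    ∑ q, S.queryProb k q * F q = ∑ q, S.queryProb k' q * F q := by
  classical
  -- Query vectors are grouped by their restriction to `𝒯`; `F` is constant on each group and
  -- privacy equates the probabilities of the groups.
  rw [← sum_fiberwise univ (fun (q : Fin M → S.𝒬) (n : 𝒯) => q n),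
    ← sum_fiberwise univ (fun (q : Fin M → S.𝒬) (n : 𝒯) => q n) fun q => S.queryProb k' q * F q]
  refine sum_congr rfl fun r _ => ?_
  by_cases hr : ∃ q₀ : Fin M → S.𝒬, (fun n : 𝒯 => q₀ n) = r
  · obtain ⟨q₀, rfl⟩ := hr
    have hk : ∀ k : Fin K, (∑ q with (fun n : 𝒯 => q n) = fun n : 𝒯 => q₀ n,
        S.queryProb k q * F q) = S.μ.real {ω | ∀ n : 𝒯, S.Q k n ω = q₀ n} * F q₀ := by
      intro k
      have h := measureReal_setOf_eq_sum (μ := S.μ) (S.measurable_queries k)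
        (fun q => (fun n : 𝒯 => q n) = fun n : 𝒯 => q₀ n)
      simp only [funext_iff] at h
      rw [h, ← sum_filter, sum_mul]
      simp only [← funext_iff]
      refine sum_congr rfl fun q hq => ?_
      rw [hF q q₀ fun n hn => congrFun (mem_filter.1 hq).2 ⟨n, hn⟩]
      rfl
    rw [hk, hk, measureReal_def, measureReal_def, S.isPrivate 𝒯 h𝒯 k k' fun n => q₀ n]
  · rw [filter_false_of_mem fun q _ h => hr ⟨q, h⟩]
    simp

/-- The entropy, in nats, of the answers in `𝒯` conditioned on the queries and the messages
in `J`. -/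
noncomputable def condAnswerEntropy (k : Fin K) (J : Finset (Fin K)) (𝒯 : Finset (Fin M)) : ℝ :=
  ∑ q, S.queryProb k q * answerEntropy (fun n => S.ans n (q n)) J 𝒯

theorem condAnswerEntropy_nonneg (k : Fin K) (J : Finset (Fin K)) (𝒯 : Finset (Fin M)) :
    0 ≤ S.condAnswerEntropy k J 𝒯 :=
  sum_nonneg fun q _ => mul_nonneg (S.queryProb_nonneg k q) (answerEntropy_nonneg _ _ _)

theorem condAnswerEntropy_mono (k : Fin K) (J : Finset (Fin K)) {s t : Finset (Fin M)}
    (h : s ⊆ t) : S.condAnswerEntropy k J s ≤ S.condAnswerEntropy k J t :=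
  sum_le_sum fun q _ =>
    mul_le_mul_of_nonneg_left (answerEntropy_mono _ _ h) (S.queryProb_nonneg k q)

/-- Average of the identity for fixed queries; a query of probability zero, where decoding may fail,
has no weight. -/
theorem condAnswerEntropy_eq_log_add {k : Fin K} {J : Finset (Fin K)} (hk : k ∉ J)
    {𝒩 : Finset (Fin M)} (h𝒩 : #𝒩 = N) :
    S.condAnswerEntropy k J 𝒩 =
      Real.log (Fintype.card 𝓦) + S.condAnswerEntropy k (insert k J) 𝒩 := by
  have : Nonempty 𝓦 := S.nonempty_messages.map fun w => w k
  unfold condAnswerEntropy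
  rw [← one_mul (Real.log _), ← S.sum_queryProb k, sum_mul, ← sum_add_distrib]
  refine sum_congr rfl fun q _ => ?_
  rcases (S.queryProb_nonneg k q).eq_or_lt with h0 | hpos
  · simp [← h0]
  · rw [answerEntropy_eq_log_add _ hk (S.decodable h𝒩 hpos), mul_add]

theorem choose_mul_condAnswerEntropy_le (k : Fin K) (J : Finset (Fin K)) (𝒩 : Finset (Fin M))
    (m : ℕ) : ((#𝒩 - 1).choose m : ℝ) * S.condAnswerEntropy k J 𝒩 ≤
      ∑ 𝒯 ∈ 𝒩.powersetCard (m + 1), S.condAnswerEntropy k J 𝒯 := by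
  refine le_sum_powersetCard_of_submodular (fun 𝒯 => S.condAnswerEntropy k J 𝒯) ?_ ?_ 𝒩 m
  · simp [condAnswerEntropy, answerEntropy_empty]
  · intro s t n hst _
    simp only [condAnswerEntropy, ← sum_add_distrib, ← mul_add]
    exact sum_le_sum fun q _ =>
      mul_le_mul_of_nonneg_left (answerEntropy_submodular _ _ _ hst) (S.queryProb_nonneg k q)

/-- By privacy, the answers for another desired message carry at least a fraction `T / N` of the
entropy. -/
theorem mul_condAnswerEntropy_le (hT : 1 ≤ T) (hTN : T ≤ N) (k k' : Fin K) (J : Finset (Fin K))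
    {𝒩 : Finset (Fin M)} (h𝒩 : #𝒩 = N) :
    (T : ℝ) / N * S.condAnswerEntropy k' J 𝒩 ≤ S.condAnswerEntropy k J 𝒩 := by
  obtain ⟨t, rfl⟩ : ∃ t, T = t + 1 := ⟨T - 1, by omega⟩
  obtain ⟨n, rfl⟩ : ∃ n, N = n + 1 := ⟨N - 1, by omega⟩
  have h1 := S.choose_mul_condAnswerEntropy_le k' J 𝒩 t
  -- The answers in `𝒯` depend only on the queries in `𝒯`, so privacy replaces k' by k before
  -- enlarging `𝒯` to `𝒩`.
  have h2 : ∀ 𝒯 ∈ 𝒩.powersetCard (t + 1),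
      S.condAnswerEntropy k' J 𝒯 ≤ S.condAnswerEntropy k J 𝒩 := by
    intro 𝒯 h𝒯
    obtain ⟨hsub, hcard⟩ := mem_powersetCard.1 h𝒯
    refine le_trans (le_of_eq ?_) (S.condAnswerEntropy_mono k J hsub)
    refine S.sum_queryProb_mul_eq hcard k' k _ fun q q' hqq => ?_
    exact answerEntropy_congr fun n hn => by rw [hqq n hn]
  have h3 := h1.trans (sum_le_card_nsmul _ _ _ h2)
  rw [card_powersetCard, h𝒩, nsmul_eq_mul, Nat.add_sub_cancel] at h3
  have hpos : (0 : ℝ) < (n + 1).choose (t + 1) := by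
    exact_mod_cast Nat.choose_pos (by omega)
  -- The ratio of the constant in Han's inequality to the number of T-subsets is T / N.
  have hch : ((n : ℝ) + 1) * n.choose t = (n + 1).choose (t + 1) * (t + 1) := by
    exact_mod_cast Nat.add_one_mul_choose_eq n t
  push_cast
  have hn0 : (0 : ℝ) < (n : ℝ) + 1 := by positivity
  refine le_of_mul_le_mul_left ?_ hpos
  calc _ = (n.choose t : ℝ) * S.condAnswerEntropy k' J 𝒩 := by
        rw [← mul_assoc, ← mul_div_assoc, ← hch]; field_simp
    _ ≤ _ := h3

/-- Here m + 1 is the number of messages outside `J`. Decoding k extracts one log |𝓦|; privacy then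
passes, at the cost of a factor T / N, to another message that is not yet known. -/
theorem log_mul_geom_sum_le (hT : 1 ≤ T) (hTN : T ≤ N) {𝒩 : Finset (Fin M)} (h𝒩 : #𝒩 = N)
    (m : ℕ) (k : Fin K) (J : Finset (Fin K)) (hk : k ∉ J) (hm : #J + (m + 1) = K) :
    Real.log (Fintype.card 𝓦) * ∑ i ∈ range (m + 1), ((T : ℝ) / N) ^ i ≤
      S.condAnswerEntropy k J 𝒩 := by
  induction m generalizing k J with
  | zero =>
    rw [S.condAnswerEntropy_eq_log_add hk h𝒩]
    simpa using S.condAnswerEntropy_nonneg k (insert k J) 𝒩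
  | succ m ih =>
    have hcard : #(insert k J) = #J + 1 := card_insert_of_notMem hk
    obtain ⟨k', hk'⟩ : ∃ k', k' ∉ insert k J := by
      by_contra! h
      have := card_eq_of_equiv_fin (Equiv.subtypeUnivEquiv h)
      omega
    have h1 := ih k' (insert k J) hk' (by omega)
    have h2 := S.mul_condAnswerEntropy_le hT hTN k k' (insert k J) h𝒩
    have hr : (0 : ℝ) ≤ T / N := by positivity
    rw [S.condAnswerEntropy_eq_log_add hk h𝒩, sum_range_succ', mul_add, pow_zero, mul_one, add_comm]
    refine add_le_add_right (le_trans (le_of_eq ?_) ((mul_le_mul_of_nonneg_left h1 hr).trans h2)) _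
    simp only [pow_succ', ← mul_sum]
    ring

/-- Conditioning on the queries reduces the entropy of an answer. -/
theorem condAnswerEntropy_singleton_le (k : Fin K) (n : Fin M) :
    S.condAnswerEntropy k ∅ {n} ≤ entropy S.μ (S.A k n) * Real.log 2 := by
  classical
  have hlaw : ∀ x, S.μ.real (S.A k n ⁻¹' {x}) = ∑ q, S.queryProb k q •
      ((#{w : Fin K → 𝓦 | S.ans n (q n) w = x} : ℝ) / Fintype.card (Fin K → 𝓦)) := by
    intro x
    have h := measureReal_setOf_eq_sum (μ := S.μ)
      (measurableSet_preimage_prodMk S.measurable_messages (S.measurable_queries k))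
      (fun z => S.ans n (z.2 n) z.1 = x)
    refine h.trans ?_
    rw [Fintype.sum_prod_type_right]
    refine sum_congr rfl fun q _ => ?_
    simp only [S.measureReal_messages_queries]
    rw [← sum_filter, sum_const, nsmul_eq_mul, smul_eq_mul]
    ring
  rw [entropy_mul_log_two]
  calc _ = ∑ x, ∑ q, S.queryProb k q • Real.negMulLog
        ((#{w : Fin K → 𝓦 | S.ans n (q n) w = x} : ℝ) / Fintype.card (Fin K → 𝓦)) := by
        rw [sum_comm]
        refine sum_congr rfl fun q _ => ?_
        rw [answerEntropy_singleton, mul_sum]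
        rfl
    -- Jensen: the law of the answer is the mixture of its laws given the queries.
    _ ≤ _ := by
        refine sum_le_sum fun x _ => ?_
        rw [hlaw]
        exact Real.concaveOn_negMulLog.le_map_sum (fun q _ => S.queryProb_nonneg k q)
          (S.sum_queryProb k) fun q _ => Set.mem_Ici.2 (by positivity)

/-- The lower bound on the download. -/
theorem logb_mul_geom_sum_le (hT : 1 ≤ T) (hTN : T ≤ N) (k : Fin K)
    {𝒩 : Finset (Fin M)} (h𝒩 : #𝒩 = N) :
    Real.logb 2 (Fintype.card 𝓦) * ∑ i ∈ range K, ((T : ℝ) / N) ^ i ≤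
      ∑ n ∈ 𝒩, entropy S.μ (S.A k n) := by
  have hK : K = K - 1 + 1 := by have := k.2; omega
  have h1 := S.log_mul_geom_sum_le hT hTN h𝒩 (K - 1) k ∅ (notMem_empty _) (by simp; omega)
  -- Han's inequality for singletons is subadditivity.
  have h2 := S.choose_mul_condAnswerEntropy_le k ∅ 𝒩 0
  rw [powersetCard_one, sum_map] at h2
  simp only [Nat.choose_zero_right, Nat.cast_one, one_mul] at h2
  have h3 := h1.trans (h2.trans (sum_le_sum fun n _ => S.condAnswerEntropy_singleton_le k n))
  rw [← sum_mul, ← hK] at h3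
  have hlog : (0 : ℝ) < Real.log 2 := Real.log_pos one_lt_two
  refine le_of_mul_le_mul_right (le_trans (le_of_eq ?_) h3) hlog
  rw [Real.logb]
  field_simp

theorem geom_sum_pos {r : ℝ} (hr : 0 ≤ r) {K : ℕ} (hK : 1 ≤ K) : 0 < ∑ i ∈ range K, r ^ i :=
  sum_pos' (fun _ _ => by positivity) ⟨0, by simp; omega, by simp⟩

theorem rateOn_le (hT : 1 ≤ T) (hTN : T ≤ N) (k : Fin K) {𝒩 : Finset (Fin M)} (h𝒩 : #𝒩 = N) :
    S.rateOn k 𝒩 ≤ (∑ i ∈ range K, ((T : ℝ) / N) ^ i)⁻¹ := by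
  have h := S.logb_mul_geom_sum_le hT hTN k h𝒩
  have hK : 1 ≤ K := by have := k.2; omega
  have hg : 0 < ∑ i ∈ range K, ((T : ℝ) / N) ^ i := geom_sum_pos (by positivity) hK
  have : Nonempty 𝓦 := S.nonempty_messages.map fun w => w k
  have hL : 0 ≤ Real.logb 2 (Fintype.card 𝓦) :=
    Real.logb_nonneg one_lt_two (by exact_mod_cast Fintype.card_pos)
  unfold rateOn
  -- With zero total download the rate is 0 by the convention x / 0 = 0.
  rcases (mul_nonneg hL hg.le |>.trans h).eq_or_lt with h0 | hpos
  · rw [← h0, div_zero]; positivity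
  · rw [div_le_iff₀ hpos, inv_mul_eq_div, le_div_iff₀ hg]
    exact h

end RobustScheme

end PIR

namespace PIR

/-! ### Schemes from secret linear automorphisms. -/

section EntropyValues

open Finset

variable {Ω : Type} [MeasurableSpace Ω] {μ : Measure Ω}
variable {α β : Type} [Fintype α] [Fintype β]

theorem entropy_eq_logb_card [IsProbabilityMeasure μ] {X : Ω → α}
    (hX : ∀ x, MeasurableSet (X ⁻¹' {x}))
    (h : ∀ x y, μ.real (X ⁻¹' {x}) = μ.real (X ⁻¹' {y})) :
    entropy μ X = Real.logb 2 (Fintype.card α) := by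
  have hs := sum_measureReal_fiber (μ := μ) hX
  obtain ⟨x₀⟩ : Nonempty α := (nonempty_of_isProbabilityMeasure μ).map X
  have hx : ∀ x, μ.real (X ⁻¹' {x}) = (Fintype.card α : ℝ)⁻¹ := by
    intro x
    rw [sum_congr rfl fun y _ => h y x, sum_const, card_univ, nsmul_eq_mul] at hs
    exact eq_inv_of_mul_eq_one_right hs
  have hc : (Fintype.card α : ℝ) ≠ 0 := by
    have : Nonempty α := ⟨x₀⟩
    exact_mod_cast Fintype.card_ne_zero
  simp only [entropy, hx, Real.negMulLog, Real.log_inv, sum_const, card_univ, nsmul_eq_mul,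
    Real.logb]
  field_simp

theorem entropy_le_logb_card [IsProbabilityMeasure μ] {X : Ω → α}
    (hX : ∀ x, MeasurableSet (X ⁻¹' {x})) : entropy μ X ≤ Real.logb 2 (Fintype.card α) := by
  have hs := sum_measureReal_fiber (μ := μ) hX
  obtain ⟨x₀⟩ : Nonempty α := (nonempty_of_isProbabilityMeasure μ).map X
  have hc : (0 : ℝ) < Fintype.card α := by
    have : Nonempty α := ⟨x₀⟩
    exact_mod_cast Fintype.card_pos
  have hJ := Real.concaveOn_negMulLog.le_map_sum (t := univ)
    (w := fun _ : α => (Fintype.card α : ℝ)⁻¹) (p := fun x => μ.real (X ⁻¹' {x}))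
    (fun _ _ => by positivity) (by simp [hc.ne']) (fun _ _ => Set.mem_Ici.2 measureReal_nonneg)
  simp only [smul_eq_mul, ← mul_sum, hs, mul_one] at hJ
  rw [← entropy_mul_log_two, Real.negMulLog, Real.log_inv, neg_mul_neg] at hJ
  rw [Real.logb, le_div_iff₀ (Real.log_pos one_lt_two)]
  exact le_of_mul_le_mul_left hJ (inv_pos.2 hc)

theorem mutualInfo_eq_zero [IsProbabilityMeasure μ] {X : Ω → α} {Y : Ω → β}
    (hX : ∀ x, MeasurableSet (X ⁻¹' {x})) (hY : ∀ y, MeasurableSet (Y ⁻¹' {y}))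
    (h : ∀ x y, μ.real ((fun ω => (X ω, Y ω)) ⁻¹' {(x, y)}) =
      μ.real (X ⁻¹' {x}) * μ.real (Y ⁻¹' {y})) : mutualInfo μ X Y = 0 := by
  have hlog : Real.log 2 ≠ 0 := (Real.log_pos one_lt_two).ne'
  have h1 : entropy μ (fun ω => (X ω, Y ω)) * Real.log 2 =
      entropy μ X * Real.log 2 + entropy μ Y * Real.log 2 := by
    rw [entropy_mul_log_two, entropy_mul_log_two, entropy_mul_log_two, Fintype.sum_prod_type]
    simp only [h, Real.negMulLog_mul, sum_add_distrib, ← sum_mul, ← mul_sum,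
      sum_measureReal_fiber hX, sum_measureReal_fiber hY, one_mul]
  rw [← add_mul] at h1
  rw [mutualInfo, mul_right_cancel₀ hlog h1, sub_self]

theorem condEntropy_eq_zero {X : Ω → α} {Y : Ω → β}
    (h : ∀ ω ω', Y ω = Y ω' → X ω = X ω') : condEntropy μ X Y = 0 := by
  classical
  rw [condEntropy, sub_eq_zero]
  unfold entropy
  rw [Fintype.sum_prod_type_right]
  refine sum_congr rfl fun y _ => ?_
  by_cases hy : ∃ ω₀, Y ω₀ = y
  · obtain ⟨ω₀, rfl⟩ := hy
    rw [sum_eq_single (X ω₀)]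
    · congr 3
      ext ω
      simp only [Set.mem_preimage, Set.mem_singleton_iff, Prod.mk.injEq, and_iff_right_iff_imp]
      exact h ω ω₀
    · intro x _ hx
      have : (fun ω => (X ω, Y ω)) ⁻¹' {(x, Y ω₀)} = ∅ := by
        ext ω
        simp only [Set.mem_preimage, Set.mem_singleton_iff, Prod.mk.injEq, Set.mem_empty_iff_false,
          iff_false, not_and]
        exact fun h1 h2 => hx (h1.symm.trans (h ω ω₀ h2))
      simp [this]
    · simp
  · have h1 : Y ⁻¹' {y} = ∅ := by
      ext ω; simpa using fun h' => hy ⟨ω, h'⟩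
    have h2 : ∀ x, (fun ω => (X ω, Y ω)) ⁻¹' {(x, y)} = ∅ := by
      intro x; ext ω; simpa using fun _ h' => hy ⟨ω, h'⟩
    simp [h1, h2]

/-- Uniformity, independence and privacy are all read off from permutations of the sample space
through this invariance. -/
theorem uniformOn_univ_setOf_comp_equiv [Finite Ω] [MeasurableSingletonClass Ω] (e : Ω ≃ Ω)
    (P : Ω → Prop) : ProbabilityTheory.uniformOn (Set.univ : Set Ω) {ω | P (e ω)} =
      ProbabilityTheory.uniformOn Set.univ {ω | P ω} := by
  have := Fintype.ofFinite Ω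
  rw [ProbabilityTheory.uniformOn_univ, ProbabilityTheory.uniformOn_univ,
    Measure.count_apply (Set.toFinite _).measurableSet,
    Measure.count_apply (Set.toFinite _).measurableSet,
    ← Set.encard_preimage_of_bijective e.bijective {ω | P ω}]
  rfl

end EntropyValues

/-- Two linearly independent families are related by an automorphism. -/
theorem exists_linearEquiv_apply_eq {F E ι : Type*} [Field F] [AddCommGroup E] [Module F E]
    [FiniteDimensional F E] {v v' : ι → E} (hv : LinearIndependent F v)
    (hv' : LinearIndependent F v') : ∃ g : E ≃ₗ[F] E, ∀ i, g (v i) = v' i := by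
  obtain ⟨g, hg⟩ := Submodule.exists_linearEquiv_restrict_eq
    ((Module.Basis.span hv).equiv (Module.Basis.span hv') (Equiv.refl ι))
  refine ⟨g, fun i => ?_⟩
  have h1 := hg (Module.Basis.span hv i)
  rw [Module.Basis.equiv_apply] at h1
  simpa [Module.Basis.span_apply] using h1.symm

/-- The scheme in which the queries are the images of fixed vectors `v k j n i` under secret
uniform automorphisms `g j`, and the answers are sums of evaluations of the messages, seen as
linear functionals. -/
theorem exists_linear_scheme {K M N T : ℕ} {𝓦 F E I : Type} [Fintype 𝓦] [Field F] [Fintype F]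
    [AddCommGroup E] [Module F E] [FiniteDimensional F E] [Fintype I]
    (φ : 𝓦 ≃ Module.Dual F E) (v : Fin K → Fin K → Fin M → I → E)
    (hpriv : ∀ 𝒯 : Finset (Fin M), 𝒯.card = T → ∀ k k' j, ∃ g : E ≃ₗ[F] E,
      ∀ n ∈ 𝒯, ∀ i, g (v k j n i) = v k' j n i)
    (hdec : ∀ 𝒩 : Finset (Fin M), 𝒩.card = N → ∀ k, ∀ z : Fin K → Module.Dual F E,
      (∀ n ∈ 𝒩, ∀ i, ∑ j, z j (v k j n i) = 0) → z k = 0) :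
    ∃ S : RobustScheme K M N T 𝓦, ∀ k n,
      entropy S.μ (S.A k n) ≤ Fintype.card I * Real.logb 2 (Fintype.card F) := by
  classical
  have : Finite E := Module.finite_of_finite F
  have : Fintype E := Fintype.ofFinite E
  have : Finite (E ≃ₗ[F] E) := DFunLike.finite _
  let Ω := (Fin K → 𝓦) × (Fin K → (E ≃ₗ[F] E))
  let mΩ : MeasurableSpace Ω := ⊤
  have hdisc : MeasurableSingletonClass Ω := ⟨fun _ => trivial⟩
  have hne : Nonempty Ω := ⟨(fun _ => φ.symm 0, fun _ => LinearEquiv.refl F E)⟩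
  let μ : Measure Ω := ProbabilityTheory.uniformOn Set.univ
  have hμ : IsProbabilityMeasure μ := ProbabilityTheory.instIsProbabilityMeasure_uniformOn_univ
  let W : Fin K → Ω → 𝓦 := fun k ω => ω.1 k
  let Q : Fin K → Fin M → Ω → (Fin K → I → E) := fun k n ω j i => ω.2 j (v k j n i)
  let ans : Fin M → (Fin K → I → E) → (Fin K → 𝓦) → (I → F) :=
    fun _ q w i => ∑ j, φ (w j) (q j i)
  have hmeas : ∀ s : Set Ω, MeasurableSet s := fun _ => trivial
  have hWk : ∀ k, entropy μ (W k) = Real.logb 2 (Fintype.card 𝓦) := fun k =>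
    entropy_eq_logb_card (fun _ => hmeas _) fun x y => by
      have := uniformOn_univ_setOf_comp_equiv (Ω := Ω) (Equiv.prodCongr
        (Equiv.piCongrRight fun _ => Equiv.swap x y) (Equiv.refl _)) (fun ω => ω.1 k = y)
      refine congrArg ENNReal.toReal (Eq.trans ?_ this)
      congr 1
      ext ω
      change ω.1 k = x ↔ Equiv.swap x y (ω.1 k) = y
      rw [Equiv.swap_apply_eq_iff, Equiv.swap_apply_right]
  have hWQ : ∀ k (w w' : Fin K → 𝓦) (q : Fin M → Fin K → I → E),
      μ.real ((fun ω => ((fun j => W j ω), (fun n => Q k n ω))) ⁻¹' {(w, q)}) =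
      μ.real ((fun ω => ((fun j => W j ω), (fun n => Q k n ω))) ⁻¹' {(w', q)}) := by
    intro k w w' q
    have := uniformOn_univ_setOf_comp_equiv (Ω := Ω) (Equiv.prodCongr
      (Equiv.swap w w') (Equiv.refl _)) (fun ω => ω.1 = w' ∧ (fun n => Q k n ω) = q)
    refine congrArg ENNReal.toReal (Eq.trans ?_ (this.trans ?_))
    · congr 1
      ext ω
      change (ω.1, fun n => Q k n ω) = (w, q) ↔
        Equiv.swap w w' ω.1 = w' ∧ (fun n => Q k n ω) = q
      rw [Equiv.swap_apply_eq_iff, Equiv.swap_apply_right, Prod.mk.injEq]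
    · congr 1
      ext ω
      change _ ↔ (ω.1, fun n => Q k n ω) = (w', q)
      rw [Prod.mk.injEq]
      rfl
  have hWW : ∀ w w' : Fin K → 𝓦,
      μ.real ((fun ω j => W j ω) ⁻¹' {w}) = μ.real ((fun ω j => W j ω) ⁻¹' {w'}) := by
    intro w w'
    have := uniformOn_univ_setOf_comp_equiv (Ω := Ω) (Equiv.prodCongr
      (Equiv.swap w w') (Equiv.refl _)) (fun ω => ω.1 = w')
    refine congrArg ENNReal.toReal (Eq.trans ?_ this)
    congr 1
    ext ω
    change ω.1 = w ↔ Equiv.swap w w' ω.1 = w'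
    rw [Equiv.swap_apply_eq_iff, Equiv.swap_apply_right]
  let S : RobustScheme K M N T 𝓦 :=
    { Ω := Ω
      μ := μ
      𝒬 := Fin K → I → E
      𝒜 := I → F
      W := W
      Q := Q
      ans := ans
      measurable_W := fun _ _ => hmeas _
      measurable_Q := fun _ _ _ => hmeas _
      messages_indep := by
        rw [Finset.sum_congr rfl fun k _ => hWk k, entropy_eq_logb_card (fun _ => hmeas _) hWW]
        simp [Real.logb_pow]
      messages_entropy := hWk
      queries_indep := by
        intro k
        refine mutualInfo_eq_zero (fun _ => hmeas _) (fun _ => hmeas _) fun w q => ?_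
        have h1 := sum_measureReal_fiber (μ := μ) (X := fun ω j => W j ω) (fun _ => hmeas _)
        rw [Finset.sum_congr rfl fun w' _ => hWW w' w, Finset.sum_const, nsmul_eq_mul] at h1
        have h2 := sum_measureReal_fiber_prodMk_left (μ := μ) (X := fun ω j => W j ω)
          (Y := fun ω n => Q k n ω) (fun _ => hmeas _) (fun _ => hmeas _) q
        rw [Finset.sum_congr rfl fun w' _ => hWQ k w' w q, Finset.sum_const, nsmul_eq_mul] at h2
        rw [← h2, ← mul_assoc, mul_comm (μ.real _), h1, one_mul]
      correct := by
        intro k 𝒩 h𝒩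
        refine condEntropy_eq_zero fun ω ω' h => ?_
        obtain ⟨hA, hQ⟩ := Prod.mk.inj h
        -- Two outcomes with equal queries and answers: their automorphisms agree on all code
        -- vectors, so the difference of the messages, pulled back by the first automorphism, is a
        -- functional to which `hdec` applies.
        have hz := hdec 𝒩 h𝒩 k (fun j => (φ (ω.1 j) - φ (ω'.1 j)) ∘ₗ (ω.2 j).toLinearMap) ?_
        · refine φ.injective (sub_eq_zero.1 ?_)
          ext x
          have := LinearMap.congr_fun hz ((ω.2 k).symm x)
          simpa using this
        · intro n hn i
          have h1 := congrFun (congrFun hA ⟨n, hn⟩) i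
          have h2 : ∀ j, ω.2 j (v k j n i) = ω'.2 j (v k j n i) := fun j =>
            congrFun (congrFun (congrFun hQ n) j) i
          simp only [ans, Q, W, ← h2] at h1
          simp [Finset.sum_sub_distrib, h1]
      isPrivate := by
        intro 𝒯 h𝒯 k k' q
        choose g hg using hpriv 𝒯 h𝒯 k' k
        -- Precomposing the secret automorphisms with `g` permutes the outcomes and turns the
        -- queries for k' on `𝒯` into those for k.
        rw [← uniformOn_univ_setOf_comp_equiv (Ω := Ω) (Equiv.prodCongr (Equiv.refl _)
          (Equiv.piCongrRight fun j =>
            (⟨fun s => (g j).trans s, fun s => (g j).symm.trans s,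
              fun s => by ext; simp, fun s => by ext; simp⟩ : (E ≃ₗ[F] E) ≃ (E ≃ₗ[F] E))))
          (fun ω => ∀ n : 𝒯, Q k' n ω = q n)]
        congr 1
        ext ω
        refine forall_congr' fun n => ?_
        change (fun j i => ω.2 j (v k j n i)) = q n ↔
          (fun j i => ω.2 j (g j (v k' j n i))) = q n
        simp only [hg _ n n.2] }
  refine ⟨S, fun k n => (entropy_le_logb_card (S.measurable_answer k n)).trans_eq ?_⟩
  change Real.logb 2 (Fintype.card (I → F)) = _
  rw [Fintype.card_fun, Nat.cast_pow, Real.logb_pow]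

end PIR

namespace PIR

/-! ### Reed–Solomon codes on disjoint blocks of coordinates. -/

section BlockCodes

open Finset Polynomial

variable {F β P : Type*} [Field F] {d : β → ℕ} {D : ℕ} (e : (Σ b, Fin (d b)) → Fin D)

/-- The vector of the powers of `x`, in the coordinates of block `b`. -/
noncomputable def blockVector (b : β) (x : F) : Fin D → F :=
  ∑ i : Fin (d b), Pi.single (e ⟨b, i⟩) (x ^ (i : ℕ))

/-- The polynomial whose values are those of the functional `z` at the block vectors. -/
noncomputable def blockPoly (z : Module.Dual F (Fin D → F)) (b : β) : F[X] :=
  ∑ i : Fin (d b), C (z (Pi.single (e ⟨b, i⟩) 1)) * X ^ (i : ℕ)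

theorem apply_blockVector (z : Module.Dual F (Fin D → F)) (b : β) (x : F) :
    z (blockVector e b x) = (blockPoly e z b).eval x := by
  rw [blockVector, blockPoly, map_sum, eval_finsetSum]
  refine sum_congr rfl fun i _ => ?_
  rw [← mul_one (x ^ (i : ℕ)), ← smul_eq_mul (x ^ (i : ℕ)), Pi.single_smul', map_smul, eval_C_mul, eval_pow, eval_X, smul_eq_mul,
    mul_comm]

theorem degree_blockPoly_lt (z : Module.Dual F (Fin D → F)) (b : β) :
    (blockPoly e z b).degree < d b := degree_sum_fin_lt _

theorem apply_single_eq_zero_of_blockPoly_eq_zero {z : Module.Dual F (Fin D → F)} {b : β}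
    (h : blockPoly e z b = 0) (i : Fin (d b)) : z (Pi.single (e ⟨b, i⟩) 1) = 0 := by
  have := congrArg (fun p => p.coeff i) h
  simpa [blockPoly, finsetSum_coeff, coeff_C_mul, coeff_X_pow, Fin.val_inj] using this

variable {e}

theorem blockVector_apply [DecidableEq β] (he : Function.Injective e) (b b' : β) (x : F)
    (i : Fin (d b')) : blockVector e b x (e ⟨b', i⟩) = if b = b' then x ^ (i : ℕ) else 0 := by
  rw [blockVector, Finset.sum_apply]
  split_ifs with h
  · subst h
    rw [sum_eq_single i]
    · simp
    · intro i' _ hi'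
      rw [Pi.single_eq_of_ne]
      intro h
      exact hi' (by simpa using (he h).symm)
    · simp
  · refine sum_eq_zero fun i' _ => ?_
    rw [Pi.single_eq_of_ne]
    intro h'
    exact h (congrArg Sigma.fst (he h')).symm

/-- Block vectors at distinct points are independent if no block has more points than
coordinates. -/
theorem linearIndepOn_blockVector [DecidableEq β] (he : Function.Injective e) {α : P → F}
    (hα : Function.Injective α) (label : P → β) (s : Finset P)
    (hs : ∀ b, #{p ∈ s | label p = b} ≤ d b) :
    LinearIndepOn F (fun p => blockVector e (label p) (α p)) (s : Set P) := by
  classical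
  rw [linearIndepOn_finset_iff]
  intro c hc p₀ hp₀
  set t := {p ∈ s | label p = label p₀} with ht
  have hp₀t : p₀ ∈ t := by simp [ht, hp₀]
  have hpow : ∀ i < d (label p₀), ∑ p ∈ t, c p * α p ^ i = 0 := by
    intro i hi
    have h := congrFun hc (e ⟨label p₀, ⟨i, hi⟩⟩)
    rw [Finset.sum_apply] at h
    simp only [Pi.smul_apply, blockVector_apply he, smul_eq_mul, mul_ite, mul_zero,
      Pi.zero_apply] at h
    rwa [← sum_filter] at h
  -- This polynomial vanishes at every point of the block except that of `p₀`; pairing it with the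
  -- relation isolates `c p₀`.
  set f : F[X] := Lagrange.nodal (t.erase p₀) α with hf
  have hdeg : f.natDegree < d (label p₀) := by
    rw [hf, Lagrange.natDegree_nodal]
    exact (card_erase_lt_of_mem hp₀t).trans_le (hs _)
  have hsum : ∑ p ∈ t, c p * f.eval (α p) = 0 := by
    simp only [eval_eq_sum_range' hdeg, mul_sum]
    rw [sum_comm]
    refine sum_eq_zero fun i hi => ?_
    rw [← mul_zero (f.coeff i), ← hpow i (mem_range.1 hi), mul_sum]
    exact sum_congr rfl fun p _ => by ring
  rw [sum_eq_single p₀] at hsum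
  · refine (mul_eq_zero.1 hsum).resolve_right ?_
    refine Lagrange.eval_nodal_not_at_node fun p hp => ?_
    exact fun h => (mem_erase.1 hp).1 (hα h).symm
  · intro p hp hne
    rw [hf, Lagrange.eval_nodal_at_node (mem_erase.2 ⟨hne, hp⟩), mul_zero]
  · exact fun h => absurd hp₀t h

end BlockCodes

/-! ### Counting symbols and code dimensions. -/

section BlockSizes

open Finset

/-- The number of symbols that each database returns for the sums of the messages in `B`. -/
def blockSize (K N T : ℕ) (B : Finset (Fin K)) : ℕ :=
  if B = ∅ then 0 else (N - T) ^ (#B - 1) * T ^ (K - #B)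

variable {K N T : ℕ}

/-- The binomial theorem for N = (N - T) + T, over subsets of the other K - 1 messages. -/
theorem sum_blockSize_mem (hTN : T ≤ N) (j : Fin K) :
    ∑ B with j ∈ B, blockSize K N T B = N ^ (K - 1) := by
  have hcard : #((univ : Finset (Fin K)).erase j) = K - 1 := by simp
  have h := sum_pow_mul_eq_add_pow (N - T) T ((univ : Finset (Fin K)).erase j)
  rw [Nat.sub_add_cancel hTN, hcard] at h
  rw [← h]
  refine sum_bij' (fun B _ => B.erase j) (fun B _ => insert j B) ?_ ?_ ?_ ?_ ?_
  · exact fun B _ => mem_powerset.2 (erase_subset_erase _ (subset_univ _))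
  · simp
  · exact fun B hB => insert_erase (mem_filter.1 hB).2
  · exact fun B hB => erase_insert fun h => by simpa using mem_powerset.1 hB h
  · intro B hB
    have hj := (mem_filter.1 hB).2
    have hpos : 0 < #B := card_pos.2 ⟨j, hj⟩
    rw [blockSize, if_neg (ne_empty_of_mem hj), card_erase_of_mem hj]
    congr 2
    omega

/-- The balance that fixes the block sizes: the B-sums of N databases suffice to decode the
interference code, and T databases see no more of its vectors than its dimension. -/
theorem mul_blockSize (hTN : T ≤ N) {B : Finset (Fin K)} {k : Fin K} (hB : B.Nonempty)
    (hk : k ∉ B) :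
    N * blockSize K N T B = T * (blockSize K N T B + blockSize K N T (insert k B)) := by
  have hpos : 0 < #B := card_pos.2 hB
  have hlt : #B < K := by
    have := card_le_univ (insert k B)
    rw [card_insert_of_notMem hk, Fintype.card_fin] at this
    omega
  rw [blockSize, if_neg hB.ne_empty, blockSize, if_neg (insert_ne_empty _ _),
    card_insert_of_notMem hk]
  obtain ⟨b, hb⟩ : ∃ b, #B = b + 1 := ⟨#B - 1, by omega⟩
  obtain ⟨m, hm⟩ : ∃ m, K - #B = m + 1 := ⟨K - #B - 1, by omega⟩
  obtain ⟨a, rfl⟩ : ∃ a, N = T + a := ⟨N - T, by omega⟩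
  have h1 : K - (#B + 1) = m := by omega
  rw [hm, h1, hb]
  simp only [Nat.add_sub_cancel, Nat.add_sub_cancel_left]
  ring

theorem sum_blockSize_mul (hK : 1 ≤ K) (hT : 1 ≤ T) (hTN : T ≤ N) :
    ((∑ B, blockSize K N T B : ℕ) : ℝ) * N = N ^ K * ∑ i ∈ range K, ((T : ℝ) / N) ^ i := by
  have hN0 : (N : ℝ) ≠ 0 := by exact_mod_cast (by omega : N ≠ 0)
  -- The closed form (N^K - T^K) / (N - T) needs T < N. For T = N only singletons B contribute, as 0
  -- ^ 0 = 1.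
  rcases hTN.eq_or_lt with rfl | hlt
  · have h1 : ∑ B, blockSize K T T B = K * T ^ (K - 1) := by
      have h := sum_powerset_apply_card
        (fun m => if m = 0 then 0 else (T - T) ^ (m - 1) * T ^ (K - m)) (x := (univ : Finset (Fin K)))
      simp only [powerset_univ, card_eq_zero] at h
      refine h.trans ?_
      rw [sum_eq_single 1]
      · simp
      · intro m _ hm
        rcases Nat.eq_zero_or_pos m with rfl | hpos
        · simp
        · rw [if_neg hpos.ne', Nat.sub_self, zero_pow (by omega)]; simp
      · intro h; simp at h; omega
    obtain ⟨K, rfl⟩ : ∃ k, K = k + 1 := ⟨K - 1, by omega⟩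
    rw [h1, div_self hN0]
    simp
    ring
  · have hsub : ((N - T : ℕ) : ℝ) = (N : ℝ) - T := Nat.cast_sub hTN
    have hne : (N : ℝ) - T ≠ 0 := by
      rw [← hsub]; exact_mod_cast (by omega : N - T ≠ 0)
    have h1 : (N - T) * ∑ B, blockSize K N T B + T ^ K = N ^ K := by
      have h := sum_pow_mul_eq_add_pow (N - T) T (univ : Finset (Fin K))
      rw [Nat.sub_add_cancel hTN, powerset_univ, ← add_sum_erase _ _ (mem_univ ∅)] at h
      simp only [card_univ, Fintype.card_fin] at h
      rw [← h, mul_sum, ← add_sum_erase _ _ (mem_univ ∅), blockSize, if_pos rfl]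
      simp only [mul_zero, zero_add, card_empty, pow_zero, one_mul, Nat.sub_zero]
      rw [add_comm]
      congr 1
      refine sum_congr rfl fun B hB => ?_
      have hB' := (mem_erase.1 hB).1
      have hpos : 0 < #B := card_pos.2 (nonempty_iff_ne_empty.2 hB')
      rw [blockSize, if_neg hB', ← mul_assoc, ← pow_succ', Nat.sub_add_cancel hpos]
    have h2 : ((N : ℝ) - T) * (∑ B, blockSize K N T B : ℕ) + T ^ K = N ^ K := by
      rw [← hsub]; exact_mod_cast h1
    have h3 := geom_sum_mul ((T : ℝ) / N) K
    have h4 : (T : ℝ) / N - 1 = -((N : ℝ) - T) / N := by field_simp; ring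
    rw [h4] at h3
    refine mul_right_cancel₀ hne ?_
    have h5 : (∑ i ∈ range K, ((T : ℝ) / N) ^ i) * ((N : ℝ) - T) = N * (1 - ((T : ℝ) / N) ^ K) := by
      field_simp at h3 ⊢
      linarith
    rw [mul_assoc ((N : ℝ) ^ K), h5, div_pow]
    field_simp
    linear_combination h2

theorem card_filter_blockPositions {M : ℕ} (𝒯 : Finset (Fin M)) (p : Finset (Fin K) → Prop)
    [DecidablePred p] : #{x : Fin M × (Σ B : Finset (Fin K), Fin (blockSize K N T B)) |
      x.1 ∈ 𝒯 ∧ p x.2.1} = #𝒯 * ∑ B with p B, blockSize K N T B := by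
  have : ({x : Fin M × (Σ B : Finset (Fin K), Fin (blockSize K N T B)) | x.1 ∈ 𝒯 ∧ p x.2.1} :
      Finset _) = 𝒯 ×ˢ (univ.filter p).sigma fun _ => univ := by
    ext x; simp
  rw [this, card_product, card_sigma]
  simp

/-- The dimension of the code of message `j` in block `B`, when message `k` is desired. The desired
message uses a single code; undesired messages use one for each set `B` of interfering messages. -/
def blockDim (K N T : ℕ) (k j : Fin K) (B : Finset (Fin K)) : ℕ :=
  if j = k then if B = ∅ then N ^ K else 0
  else if j ∈ B ∧ k ∉ B then N * blockSize K N T B else 0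

theorem sum_blockDim_self (k : Fin K) : ∑ B, blockDim K N T k k B = N ^ K := by
  simp only [blockDim, if_true]
  rw [sum_ite_eq' univ ∅ fun _ => N ^ K, if_pos (mem_univ _)]

/-- All the codes of a message fit into disjoint sets of coordinates of F^(N^K). -/
theorem sum_blockDim_le (hTN : T ≤ N) (k j : Fin K) : ∑ B, blockDim K N T k j B ≤ N ^ K := by
  by_cases hjk : j = k
  · subst hjk; exact (sum_blockDim_self j).le
  · have hK : K = K - 1 + 1 := by have := k.2; omega
    simp only [blockDim, if_neg hjk]
    calc _ ≤ ∑ B : Finset (Fin K), if j ∈ B then N * blockSize K N T B else 0 := by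
          refine sum_le_sum fun B _ => ?_
          split_ifs with h1 h2
          · exact le_rfl
          · exact absurd h1.1 h2
          · exact Nat.zero_le _
          · exact le_rfl
      _ = N * N ^ (K - 1) := by rw [← sum_filter, ← mul_sum, sum_blockSize_mem hTN]
      _ = N ^ K := by rw [← pow_succ', ← hK]

theorem exists_blockEmbedding (hTN : T ≤ N) (k j : Fin K) :
    ∃ e : (Σ B, Fin (blockDim K N T k j B)) → Fin (N ^ K), Function.Injective e := by
  obtain ⟨e⟩ := Function.Embedding.nonempty_of_card_le
    (α := Σ B, Fin (blockDim K N T k j B)) (β := Fin (N ^ K)) (by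
      simpa [Fintype.card_sigma] using sum_blockDim_le hTN k j)
  exact ⟨e, e.injective⟩

/-- The block in which message `j` is coded in sums of the messages in `B`, when message `k` is
desired. -/
def blockLabel (k j : Fin K) (B : Finset (Fin K)) : Finset (Fin K) :=
  if j = k then ∅ else B.erase k

/-- The count behind privacy: T databases hold at most as many vectors of a code as its dimension.
For an undesired message, a code labelled `B` serves only `B` and `insert k B`. -/
theorem mul_sum_blockSize_le_blockDim (hTN : T ≤ N) (k j : Fin K)
    (B : Finset (Fin K)) :
    T * ∑ B' with j ∈ B' ∧ blockLabel k j B' = B, blockSize K N T B' ≤ blockDim K N T k j B := by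
  have hK : K = K - 1 + 1 := by have := k.2; omega
  unfold blockLabel blockDim
  by_cases hjk : j = k
  · simp only [if_pos hjk]
    by_cases hB : B = ∅
    · subst hB
      simp only [and_true, if_true]
      rw [sum_blockSize_mem hTN]
      calc T * N ^ (K - 1) ≤ N * N ^ (K - 1) := Nat.mul_le_mul_right _ hTN
        _ = N ^ K := by rw [← pow_succ', ← hK]
    · simp [Ne.symm hB]
  · simp only [if_neg hjk]
    by_cases hB : j ∈ B ∧ k ∉ B
    · rw [if_pos hB, mul_blockSize hTN ⟨j, hB.1⟩ hB.2]
      have hne : B ≠ insert k B := fun h => hB.2 (h ▸ mem_insert_self k B)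
      rw [← sum_pair hne]
      refine Nat.mul_le_mul_left _ (sum_le_sum_of_subset fun B' hB' => ?_)
      obtain ⟨_, h⟩ := (mem_filter.1 hB').2
      rw [mem_insert, mem_singleton]
      by_cases hkB : k ∈ B'
      · right; rw [← h, insert_erase hkB]
      · left; rw [← h, erase_eq_of_notMem hkB]
    · rw [if_neg hB, filter_false_of_mem, sum_empty, mul_zero]
      rintro B' - ⟨hj, rfl⟩
      exact hB ⟨mem_erase.2 ⟨hjk, hj⟩, notMem_erase _ _⟩

end BlockSizes

end PIR

namespace PIR

/-! ### The optimal scheme. -/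

section CapacityScheme

open Finset Polynomial

variable {K M N T : ℕ} {F : Type} [Field F]

/-- The vector by which message `j` enters the sums of the messages in `x.2.1`, at position `x`,
when message `k` is desired. -/
noncomputable def codeVector
    (e : ∀ k j : Fin K, (Σ B, Fin (blockDim K N T k j B)) → Fin (N ^ K))
    (α : Fin M × (Σ B : Finset (Fin K), Fin (blockSize K N T B)) → F) (k j : Fin K)
    (x : Fin M × (Σ B : Finset (Fin K), Fin (blockSize K N T B))) : Fin (N ^ K) → F :=
  if j ∈ x.2.1 then blockVector (e k j) (blockLabel k j x.2.1) (α x) else 0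

variable {e : ∀ k j : Fin K, (Σ B, Fin (blockDim K N T k j B)) → Fin (N ^ K)}
  {α : Fin M × (Σ B : Finset (Fin K), Fin (blockSize K N T B)) → F}

/-- Whichever message is desired, the nonzero vectors held by T databases are independent, and any
two independent families with the same index set are related by an automorphism. -/
theorem exists_linearEquiv_codeVector (hTN : T ≤ N) (he : ∀ k j, Function.Injective (e k j))
    (hα : Function.Injective α) {𝒯 : Finset (Fin M)} (h𝒯 : #𝒯 = T) (k k' j : Fin K) :
    ∃ g : (Fin (N ^ K) → F) ≃ₗ[F] (Fin (N ^ K) → F),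
      ∀ n ∈ 𝒯, ∀ i, g (codeVector e α k j (n, i)) = codeVector e α k' j (n, i) := by
  set s : Finset (Fin M × (Σ B : Finset (Fin K), Fin (blockSize K N T B))) :=
    {x | x.1 ∈ 𝒯 ∧ j ∈ x.2.1} with hs
  have hind : ∀ k, LinearIndependent F fun x : s =>
      blockVector (e k j) (blockLabel k j x.1.2.1) (α x) := by
    intro k
    refine linearIndepOn_blockVector (he k j) hα
      (fun x : Fin M × (Σ B : Finset (Fin K), Fin (blockSize K N T B)) => blockLabel k j x.2.1) s ?_
    intro B
    rw [hs, filter_filter]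
    simp only [and_assoc]
    rw [card_filter_blockPositions 𝒯 (fun B' => j ∈ B' ∧ blockLabel k j B' = B), h𝒯]
    exact mul_sum_blockSize_le_blockDim hTN k j B
  obtain ⟨g, hg⟩ := exists_linearEquiv_apply_eq (hind k) (hind k')
  refine ⟨g, fun n hn i => ?_⟩
  unfold codeVector
  by_cases hj : j ∈ i.1
  · rw [if_pos hj, if_pos hj]
    exact hg ⟨(n, i), by simp [hs, hn, hj]⟩
  · rw [if_neg hj, if_neg hj, map_zero]

theorem eq_zero_of_sum_apply_codeVector_eq_zero (hTN : T ≤ N)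
    (he : ∀ k j, Function.Injective (e k j)) (hα : Function.Injective α) {𝒩 : Finset (Fin M)}
    (h𝒩 : #𝒩 = N) (k : Fin K) (z : Fin K → Module.Dual F (Fin (N ^ K) → F))
    (hz : ∀ n ∈ 𝒩, ∀ i, ∑ j, z j (codeVector e α k j (n, i)) = 0) : z k = 0 := by
  have hK : K = K - 1 + 1 := by have := k.2; omega
  set R : Fin K → Finset (Fin K) → F[X] := fun j B => blockPoly (e k j) (z j) B with hR
  have happ : ∀ x : Fin M × (Σ B : Finset (Fin K), Fin (blockSize K N T B)), x.1 ∈ 𝒩 →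
      ∑ j ∈ x.2.1, (R j (blockLabel k j x.2.1)).eval (α x) = 0 := by
    intro x hx
    rw [← hz x.1 hx x.2, ← sum_filter_add_sum_filter_not univ (· ∈ x.2.1),
      sum_eq_zero (s := univ.filter (· ∉ x.2.1)), add_zero, filter_mem_eq_inter, univ_inter]
    · refine sum_congr rfl fun j hj => ?_
      rw [codeVector, if_pos hj, apply_blockVector]
    · intro j hj
      rw [codeVector, if_neg (mem_filter.1 hj).2, map_zero]
  -- The interference polynomial has degree below the number of its zeros, one for each B-sum of the
  -- N databases.
  have hint : ∀ B : Finset (Fin K), k ∉ B → ∑ j ∈ B, R j B = 0 := by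
    intro B hk
    refine Polynomial.eq_zero_of_degree_lt_of_eval_index_eq_zero
      (s := ({x | x.1 ∈ 𝒩 ∧ x.2.1 = B} :
        Finset (Fin M × (Σ B : Finset (Fin K), Fin (blockSize K N T B))))) (v := α)
      hα.injOn ?_ ?_
    · rw [card_filter_blockPositions 𝒩 (fun B' => B' = B), h𝒩, filter_eq' univ B,
        if_pos (mem_univ _), sum_singleton, degree_lt_iff_coeff_zero]
      intro m hm
      rw [finsetSum_coeff]
      refine sum_eq_zero fun j hj => ?_
      refine (degree_lt_iff_coeff_zero _ _).1 (degree_blockPoly_lt (e k j) (z j) B) m ?_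
      have hjk : j ≠ k := fun h => hk (h ▸ hj)
      rwa [blockDim, if_neg hjk, if_pos ⟨hj, hk⟩]
    · rintro x hx
      obtain ⟨hx1, rfl⟩ := (mem_filter.1 hx).2
      rw [eval_finsetSum, ← happ x hx1]
      refine sum_congr rfl fun j hj => ?_
      have hjk : j ≠ k := fun h => hk (h ▸ hj)
      rw [blockLabel, if_neg hjk, erase_eq_of_notMem hk]
  -- With the interference gone, the polynomial of the desired message has N · N^(K-1) zeros and
  -- degree below N^K.
  have hdes : R k ∅ = 0 := by
    refine Polynomial.eq_zero_of_degree_lt_of_eval_index_eq_zero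
      (s := ({x | x.1 ∈ 𝒩 ∧ k ∈ x.2.1} :
        Finset (Fin M × (Σ B : Finset (Fin K), Fin (blockSize K N T B))))) (v := α)
      hα.injOn ?_ ?_
    · rw [card_filter_blockPositions 𝒩 (fun B' => k ∈ B'), h𝒩, sum_blockSize_mem hTN,
        ← pow_succ', ← hK]
      refine (degree_blockPoly_lt (e k k) (z k) ∅).trans_eq ?_
      rw [blockDim, if_pos rfl, if_pos rfl]
    · intro x hx
      obtain ⟨hx1, hkx⟩ := (mem_filter.1 hx).2
      have h1 := happ x hx1
      rw [← add_sum_erase _ _ hkx, blockLabel, if_pos rfl] at h1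
      have h2 := congrArg (eval (α x)) (hint (x.2.1.erase k) (notMem_erase _ _))
      rw [eval_finsetSum, eval_zero] at h2
      rw [← h1, left_eq_add, ← h2]
      refine sum_congr rfl fun j hj => ?_
      rw [blockLabel, if_neg (mem_erase.1 hj).1]
  -- The code of the desired message fills all N^K coordinates, so its polynomial determines the
  -- functional.
  have hsurj : Function.Surjective (e k k) := by
    refine ((Fintype.bijective_iff_injective_and_card _).2 ⟨he k k, ?_⟩).2
    simpa [Fintype.card_sigma] using sum_blockDim_self k
  refine LinearMap.pi_ext' fun l => LinearMap.ext_ring ?_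
  obtain ⟨⟨B, i⟩, rfl⟩ := hsurj l
  have hB : B = ∅ := by
    by_contra hB
    have h0 : blockDim K N T k k B = 0 := by rw [blockDim, if_pos rfl, if_neg hB]
    have := i.2
    omega
  subst hB
  exact apply_single_eq_zero_of_blockPoly_eq_zero (e k k) hdes i

/-- There are schemes over bit strings in which every database returns the optimal number of
bits. -/
theorem exists_scheme_entropy_le (hTN : T ≤ N) :
    ∃ m : ℕ, 0 < m ∧ ∃ S : RobustScheme K M N T (Fin (m * N ^ K) → Bool), ∀ k n,
      entropy S.μ (S.A k n) ≤ (∑ B, blockSize K N T B : ℕ) * m := by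
  classical
  let I := Σ B : Finset (Fin K), Fin (blockSize K N T B)
  -- Large enough for 2^m elements to give every position its own point; the + 1 keeps m nonzero.
  -- Characteristic 2 makes the messages bit strings of length m N^K.
  let m := Fintype.card (Fin M × I) + 1
  let F := GaloisField 2 m
  have hFcard : Nat.card F = 2 ^ m := GaloisField.card 2 m (Nat.succ_ne_zero _)
  have : Finite F := Nat.finite_of_card_ne_zero (by rw [hFcard]; positivity)
  have : Fintype F := Fintype.ofFinite F
  rw [Nat.card_eq_fintype_card] at hFcard
  obtain ⟨α⟩ := Function.Embedding.nonempty_of_card_le (α := Fin M × I) (β := F) (by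
    rw [hFcard]
    exact (Nat.le_succ _).trans (Nat.lt_two_pow_self (n := m)).le)
  choose e he using exists_blockEmbedding (K := K) hTN
  have : Finite (Module.Dual F (Fin (N ^ K) → F)) := Module.finite_of_finite F
  have : Fintype (Module.Dual F (Fin (N ^ K) → F)) := Fintype.ofFinite _
  have hcard : Fintype.card (Fin (m * N ^ K) → Bool) =
      Fintype.card (Module.Dual F (Fin (N ^ K) → F)) := by
    rw [← Fintype.card_congr ((Pi.basisFun F (Fin (N ^ K))).constr F (M' := F)).toEquiv]
    simp only [Fintype.card_fun, Fintype.card_bool, Fintype.card_fin, hFcard, ← pow_mul]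
  obtain ⟨S, hS⟩ := exists_linear_scheme (K := K) (M := M) (N := N) (T := T)
    (Fintype.equivOfCardEq hcard) (fun k j n i => codeVector e α k j (n, i))
    (fun 𝒯 h𝒯 => exists_linearEquiv_codeVector hTN he α.injective h𝒯)
    (fun 𝒩 h𝒩 => eq_zero_of_sum_apply_codeVector_eq_zero hTN he α.injective h𝒩)
  refine ⟨m, Nat.succ_pos _, S, fun k n => (hS k n).trans_eq ?_⟩
  rw [hFcard, Nat.cast_pow, Real.logb_pow, Nat.cast_two, Real.logb_self_eq_one one_lt_two, mul_one]
  simp [Fintype.card_sigma]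

end CapacityScheme

theorem RobustScheme.rate_le_rateOn {K M N T : ℕ} {𝓦 : Type} [Fintype 𝓦]
    (S : RobustScheme K M N T 𝓦) (k : Fin K) {𝒩 : Finset (Fin M)} (h𝒩 : 𝒩.card = N) :
    S.rate ≤ S.rateOn k 𝒩 :=
  ciInf_le (Set.finite_range _).bddBelow
    ((k, ⟨𝒩, h𝒩⟩) : Fin K × {𝒩 : Finset (Fin M) // 𝒩.card = N})

/-- There is a scheme over bit strings whose rate attains the upper bound. -/
theorem exists_scheme_le_rate {K M N T : ℕ} (hK : 1 ≤ K) (hT : 1 ≤ T) (hTN : T ≤ N)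
    (hNM : N ≤ M) : ∃ L : ℕ, 0 < L ∧ ∃ S : RobustScheme K M N T (Fin L → Bool),
      (∑ i ∈ Finset.range K, ((T : ℝ) / (N : ℝ)) ^ i)⁻¹ ≤ S.rate := by
  obtain ⟨m, hm, S, hS⟩ := exists_scheme_entropy_le (K := K) (M := M) hTN
  have hL : 0 < m * N ^ K := Nat.mul_pos hm (pow_pos (by omega) _)
  refine ⟨m * N ^ K, hL, S, ?_⟩
  obtain ⟨𝒩₀, -, h𝒩₀⟩ := Finset.exists_subset_card_eq (s := (Finset.univ : Finset (Fin M)))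
    (n := N) (by simpa using hNM)
  have : Nonempty (Fin K × {𝒩 : Finset (Fin M) // 𝒩.card = N}) := ⟨(⟨0, hK⟩, ⟨𝒩₀, h𝒩₀⟩)⟩
  refine le_ciInf ?_
  rintro ⟨k, 𝒩, h𝒩⟩
  have hlow := S.logb_mul_geom_sum_le hT hTN k h𝒩
  have hup := Finset.sum_le_card_nsmul 𝒩 _ _ fun n _ => hS k n
  have hg : 0 < ∑ i ∈ Finset.range K, ((T : ℝ) / N) ^ i :=
    RobustScheme.geom_sum_pos (by positivity) hK
  have hlog : Real.logb 2 (Fintype.card (Fin (m * N ^ K) → Bool)) = (m * N ^ K : ℕ) := by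
    simp [Real.logb_pow]
  have hL' : (0 : ℝ) < (m * N ^ K : ℕ) := by exact_mod_cast hL
  unfold RobustScheme.rateOn
  rw [hlog] at hlow ⊢
  -- The converse supplies the positivity of the download needed to clear denominators.
  rw [inv_eq_one_div, div_le_div_iff₀ hg ((mul_pos hL' hg).trans_le hlow), one_mul]
  refine hup.trans_eq ?_
  rw [h𝒩, nsmul_eq_mul, mul_left_comm, ← mul_assoc, sum_blockSize_mul hK hT hTN]
  push_cast
  ring

end PIR

theorem theorem2 (K M N T : ℕ) (hK : 1 ≤ K) (hT : 1 ≤ T) (hTN : T ≤ N) (hNM : N ≤ M) :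
    PIR.IsCapacity K M N T (∑ i ∈ Finset.range K, ((T : ℝ) / (N : ℝ)) ^ i)⁻¹ ∧
    ∀ (𝓦 : Type) [Fintype 𝓦] (S : PIR.RobustScheme K M N T 𝓦) (k : Fin K)
      (𝒩 : Finset (Fin M)), 𝒩.card = N →
      S.rateOn k 𝒩 ≤ (∑ i ∈ Finset.range K, ((T : ℝ) / (N : ℝ)) ^ i)⁻¹ := by
  refine ⟨⟨?_, fun C hC => ?_⟩, fun 𝓦 _ S k 𝒩 h𝒩 => S.rateOn_le hT hTN k h𝒩⟩
  · rintro _ ⟨L, -, S, rfl⟩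
    obtain ⟨𝒩, -, h𝒩⟩ := Finset.exists_subset_card_eq (s := (Finset.univ : Finset (Fin M)))
      (n := N) (by simpa using hNM)
    exact (S.rate_le_rateOn ⟨0, hK⟩ h𝒩).trans (S.rateOn_le hT hTN _ h𝒩)
  · obtain ⟨L, hL, S, hS⟩ := PIR.exists_scheme_le_rate hK hT hTN hNM
    exact hS.trans (hC ⟨L, hL, S, rfl⟩)
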